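/- **Setting.** A combinatorial optimization problem is a class of instances $I$, each given by a finite code. To an instance belong a number $n\ge 0$ of items, a matrix $A\in\mathbb{R}^{m\times n}$ and a vector $b\in\mathbb{R}^m$, and its feasible set is $\{x\in\{0,1\}^n : Ax\ge b\}$. (The code need not list $A$ and $b$, which may have exponentially many rows.) For $x\in\{0,1\}^n$ let $$\mathcal X(x)=\{y\in\{0,1\}^n : A(x+y)\ge b,\ x+y\le \mathbf 1\}.$$ **Assumption (A).** For every instance, $P=\{x\in[0,1]^n : Ax\ge b\}$ is an integral polyhedron. **Two-completion problem.** Given the code of an instance, nonnegative rational vectors $\tilde a,\tilde b,\tilde c\in\mathbb{Q}^n_{+}$ and a rational $\tilde v\ge 0$, minimize $\tilde a^t x+\tilde b^t y^{(1)}+\tilde c^t y^{(2)}+\tilde v$ over all $x\in\{0,1\}^n$ and $y^{(1)},y^{(2)}\in\mathcal X(x)$. **Robust two-stage problem with two-stage continuous budgeted uncertainty.** Given the code of an instance, rational vectors with $0\le\underline c\le\overline c$ and $0\le\underline d\le\overline d$, and a rational budget $\Gamma\ge 0$, solve $$\min_{x\in\{0,1\}^n}\mathrm{Adv}(x),\qquad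 \mathrm{Adv}(x)=\max_{c\in\mathcal U}\ \min_{y\in\mathcal X(x)}\ \max_{d\in\mathcal U(c)}\ c^t x+d^t y,\qquad \min\emptyset=\infty,$$ where $$\mathcal U=\Big\{c\in\mathbb{R}^n_+ : c_i=\underline c_i+(\overline c_i-\underline c_i)\delta_i,\ \delta_i\in[0,1]\ \forall i,\ \textstyle\sum_i\delta_i\le\Gamma\Big\},$$ $$\mathcal U(c)=\Big\{d\in\mathbb{R}^n_+ : d_i=\underline d_i+(\overline d_i-\underline d_i)\delta_i,\ \delta_i\in[0,1]\ \forall i,\ \textstyle\sum_i\delta_i\le\Gamma-\sum_i\frac{c_i-\underline c_i}{\overline c_i-\underline c_i}\Big\},$$ and a summand with $\overline c_i=\underline c_i$ in the last sum is read as $0$. A solution is a first-stage vector $x$, of value $\mathrm{Adv}(x)$. **Approximability.** Let $\alpha$ assign to every instance $I$ of the combinatorial optimization problem a real number $\alpha(I)\ge 1$ (for example a constant). A minimization problem over these instances is $\alpha$-approximable if some algorithm, running in time polynomial in the binary encoding length of its input, always returns a solution of value at most $\alpha(I)$ times the optimal value. An infeasible solution has value $\infty$, so the requirement on the value is void when the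 optimal value is $\infty$. **Theorem.** Let a combinatorial optimization problem satisfy (A). If its two-completion problem is $\alpha$-approximable, then its robust two-stage problem with two-stage continuous budgeted uncertainty is $\alpha$-approximable as well. -/

import Mathlib

open scoped Matrix

namespace TwoStage

/-! ## A machine model: while programs over trees of rationals, with logarithmic cost -/

/-- The values a program works on: binary trees whose leaves are rational numbers. -/
inductive Data where
  | num (q : ℚ) : Data
  | pair (a b : Data) : Data

namespace Data

/-- Encoding length: one unit for each node, plus the binary lengths of the numerator and the
denominator (in lowest terms) for each leaf. -/
def size : Data → ℕ
  | num q => 1 + Nat.size q.num.natAbs + Nat.size q.den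
  | pair a b => 1 + a.size + b.size

/-- The number at a leaf; `0` at an inner node. -/
def toRat : Data → ℚ
  | num q => q
  | pair _ _ => 0

/-- The left subtree; the leaf `0` if there is none. -/
def fst : Data → Data
  | num _ => num 0
  | pair a _ => a

/-- The right subtree; the leaf `0` if there is none. -/
def snd : Data → Data
  | num _ => num 0
  | pair _ b => b

/-- The leaf `1` at an inner node, and the leaf `0` at a leaf. -/
def isPair : Data → Data
  | num _ => num 0
  | pair _ _ => num 1

/-- A finite list of values as a value; the empty list is the leaf `0`. -/
def list : List Data → Data
  | [] => num 0
  | d :: ds => pair d (list ds)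

/-- A rational vector as a value, the list of its entries. -/
def vec {n : ℕ} (f : Fin n → ℚ) : Data :=
  list (List.ofFn fun i => num (f i))

end Data

/-- The memory of a program: one value for each of its variables, numbered by `ℕ`. A program
mentions only finitely many variables. -/
abbrev Store : Type := ℕ → Data

/-- Expressions. -/
inductive Term where
  | var (v : ℕ) : Term
  | const (q : ℚ) : Term
  | pair (e f : Term) : Term
  | fst (e : Term) : Term
  | snd (e : Term) : Term
  | isPair (e : Term) : Term
  | add (e f : Term) : Term
  | sub (e f : Term) : Term
  | mul (e f : Term) : Term
  | div (e f : Term) : Term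
  | le (e f : Term) : Term

namespace Term

/-- The value of an expression. Arithmetic reads an inner node as `0`, division by `0` gives `0`,
and a comparison gives `1` or `0`. -/
def eval (s : Store) : Term → Data
  | var v => s v
  | const q => .num q
  | pair e f => .pair (e.eval s) (f.eval s)
  | fst e => (e.eval s).fst
  | snd e => (e.eval s).snd
  | isPair e => (e.eval s).isPair
  | add e f => .num ((e.eval s).toRat + (f.eval s).toRat)
  | sub e f => .num ((e.eval s).toRat - (f.eval s).toRat)
  | mul e f => .num ((e.eval s).toRat * (f.eval s).toRat)
  | div e f => .num ((e.eval s).toRat / (f.eval s).toRat)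
  | le e f => .num (if (e.eval s).toRat ≤ (f.eval s).toRat then 1 else 0)

/-- The cost of an evaluation: the sum of the encoding lengths of the values of all
subexpressions (so every intermediate result is paid for by its bit length). -/
def cost (s : Store) : Term → ℕ
  | var v => (s v).size
  | const q => (Data.num q).size
  | pair e f => e.cost s + f.cost s + ((pair e f).eval s).size
  | fst e => e.cost s + ((fst e).eval s).size
  | snd e => e.cost s + ((snd e).eval s).size
  | isPair e => e.cost s + ((isPair e).eval s).size
  | add e f => e.cost s + f.cost s + ((add e f).eval s).size
  | sub e f => e.cost s + f.cost s + ((sub e f).eval s).size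
  | mul e f => e.cost s + f.cost s + ((mul e f).eval s).size
  | div e f => e.cost s + f.cost s + ((div e f).eval s).size
  | le e f => e.cost s + f.cost s + ((le e f).eval s).size

end Term

/-- Programs. -/
inductive Program where
  | assign (v : ℕ) (e : Term) : Program
  | seq (c₁ c₂ : Program) : Program
  | ite (e : Term) (c₁ c₂ : Program) : Program
  | loop (e : Term) (c : Program) : Program

/-- `c.Runs s t s'`: started in the store `s`, the program `c` halts after `t` time units in the
store `s'`. A test succeeds unless its value is the leaf `0`; `loop e c` is "while `e` do `c`". -/
inductive Program.Runs : Program → Store → ℕ → Store → Prop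
  | assign (v : ℕ) (e : Term) (s : Store) :
      Runs (.assign v e) s (e.cost s + 1) (Function.update s v (e.eval s))
  | seq {c₁ c₂ : Program} {s s' s'' : Store} {t₁ t₂ : ℕ} :
      Runs c₁ s t₁ s' → Runs c₂ s' t₂ s'' → Runs (.seq c₁ c₂) s (t₁ + t₂) s''
  | ite_true {e : Term} {c₁ c₂ : Program} {s s' : Store} {t : ℕ} :
      e.eval s ≠ .num 0 → Runs c₁ s t s' → Runs (.ite e c₁ c₂) s (e.cost s + 1 + t) s'
  | ite_false {e : Term} {c₁ c₂ : Program} {s s' : Store} {t : ℕ} :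
      e.eval s = .num 0 → Runs c₂ s t s' → Runs (.ite e c₁ c₂) s (e.cost s + 1 + t) s'
  | loop_true {e : Term} {c : Program} {s s' s'' : Store} {t₁ t₂ : ℕ} :
      e.eval s ≠ .num 0 → Runs c s t₁ s' → Runs (.loop e c) s' t₂ s'' →
      Runs (.loop e c) s (e.cost s + 1 + t₁ + t₂) s''
  | loop_false {e : Term} {c : Program} {s : Store} :
      e.eval s = .num 0 → Runs (.loop e c) s (e.cost s + 1) s

/-- The initial store: the input is in variable `0`, and all other variables are `0`. -/
def initStore (d : Data) : Store := fun v => if v = 0 then d else .num 0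

/-! ## Minimization problems and approximability -/

/-- A minimization problem: encoded instances, encoded candidate solutions of each instance, and
the objective, which is `⊤` at candidates that are not feasible. -/
structure MinProblem where
  Inst : Type
  code : Inst → Data
  Sol : Inst → Type
  solCode : (i : Inst) → Sol i → Data
  value : (i : Inst) → Sol i → EReal

/-- The optimal value, `⊤` if there is no feasible solution. -/
noncomputable def MinProblem.opt (Q : MinProblem) (i : Q.Inst) : EReal :=
  ⨅ s : Q.Sol i, Q.value i s

/-- `Q` is `α`-approximable: some program computes, for every instance `i`, in time polynomial in
the encoding length of `i`, a solution whose value is at most `α i` times the optimal value. -/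
def MinProblem.Approximable (Q : MinProblem) (α : Q.Inst → ℝ) : Prop :=
  ∃ (c : Program) (p : Polynomial ℕ), ∀ i : Q.Inst,
    ∃ (sol : Q.Sol i) (t : ℕ) (s : Store),
      c.Runs (initStore (Q.code i)) t s ∧
      t ≤ p.eval (Q.code i).size ∧
      s 0 = Q.solCode i sol ∧
      Q.value i sol ≤ (α i : EReal) * Q.opt i

/-! ## Combinatorial optimization problems -/

/-- Elements of `{0,1}ⁿ`. -/
abbrev BinVec (n : ℕ) : Type := Fin n → Bool

/-- A 0-1 vector as a real vector. -/
def BinVec.toReal {n : ℕ} (x : BinVec n) : Fin n → ℝ := fun i => if x i then 1 else 0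

/-- A 0-1 vector as a program value. -/
def BinVec.code {n : ℕ} (x : BinVec n) : Data :=
  Data.vec fun i => if x i then 1 else 0

/-- The constraints `A x ≥ b` of a nominal instance with `n` items. -/
structure NominalInstance where
  n : ℕ
  m : ℕ
  A : Matrix (Fin m) (Fin n) ℝ
  b : Fin m → ℝ

namespace NominalInstance

variable (N : NominalInstance)

/-- The polyhedron `{x ∈ [0,1]ⁿ : A x ≥ b}` of the LP relaxation. -/
def relaxation : Set (Fin N.n → ℝ) :=
  {x | (∀ i, x i ∈ Set.Icc (0 : ℝ) 1) ∧ N.b ≤ N.A *ᵥ x}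

/-- The feasible second-stage solutions `{y ∈ {0,1}ⁿ : A (x + y) ≥ b, x + y ≤ 1}`. -/
def secondStage (x : BinVec N.n) : Set (BinVec N.n) :=
  {y | N.b ≤ N.A *ᵥ (x.toReal + y.toReal) ∧ x.toReal + y.toReal ≤ 1}

end NominalInstance

/-- A polyhedron with vertices is integral if all its vertices are integral. -/
def IsIntegralPolyhedron {n : ℕ} (S : Set (Fin n → ℝ)) : Prop :=
  ∀ x ∈ S.extremePoints ℝ, ∀ i, ∃ k : ℤ, x i = k

/-- A combinatorial optimization problem: a class of encoded instances (graphs, say), each with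
a description of its feasible set by linear inequalities. The encoding need not list these
inequalities, as there may be exponentially many of them. -/
structure CombinatorialProblem where
  Inst : Type
  code : Inst ↪ Data
  nominal : Inst → NominalInstance

/-- The LP relaxation of every instance is an integral polyhedron. -/
def CombinatorialProblem.HasIntegralRelaxation (P : CombinatorialProblem) : Prop :=
  ∀ I : P.Inst, IsIntegralPolyhedron (P.nominal I).relaxation

/-! ## The two-stage problem with two completions -/

/-- Nonnegative coefficients of the two-completion problem. -/
structure PairCosts (n : ℕ) where
  a : Fin n → ℚ
  b : Fin n → ℚ
  c : Fin n → ℚ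
  v : ℚ
  a_nonneg : ∀ i, 0 ≤ a i
  b_nonneg : ∀ i, 0 ≤ b i
  c_nonneg : ∀ i, 0 ≤ c i
  v_nonneg : 0 ≤ v

/-- The coefficients as a program value. -/
def PairCosts.code {n : ℕ} (w : PairCosts n) : Data :=
  Data.list [Data.vec w.a, Data.vec w.b, Data.vec w.c, Data.num w.v]

open Classical in
/-- Minimize `a·x + b·y¹ + c·y² + v` over 0-1 vectors such that `y¹` and `y²` are both feasible
second-stage solutions for `x`. -/
noncomputable def CombinatorialProblem.pairProblem (P : CombinatorialProblem) : MinProblem where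
  Inst := Σ I : P.Inst, PairCosts (P.nominal I).n
  code := fun J => Data.pair (P.code J.1) J.2.code
  Sol := fun J =>
    BinVec (P.nominal J.1).n × BinVec (P.nominal J.1).n × BinVec (P.nominal J.1).n
  solCode := fun _ s => Data.list [s.1.code, s.2.1.code, s.2.2.code]
  value := fun J s =>
    if s.2.1 ∈ (P.nominal J.1).secondStage s.1 ∧ s.2.2 ∈ (P.nominal J.1).secondStage s.1 then
      (((fun i => (J.2.a i : ℝ)) ⬝ᵥ s.1.toReal + (fun i => (J.2.b i : ℝ)) ⬝ᵥ s.2.1.toReal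
        + (fun i => (J.2.c i : ℝ)) ⬝ᵥ s.2.2.toReal + (J.2.v : ℝ) : ℝ) : EReal)
    else ⊤

/-! ## The robust two-stage problem with continuous budgeted uncertainty -/

/-- The lower and upper costs of the items in both stages, and the budget. -/
structure BudgetedCosts (n : ℕ) where
  cLo : Fin n → ℚ
  cHi : Fin n → ℚ
  dLo : Fin n → ℚ
  dHi : Fin n → ℚ
  Γ : ℚ
  cLo_nonneg : ∀ i, 0 ≤ cLo i
  cLo_le : ∀ i, cLo i ≤ cHi i
  dLo_nonneg : ∀ i, 0 ≤ dLo i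
  dLo_le : ∀ i, dLo i ≤ dHi i
  Γ_nonneg : 0 ≤ Γ

namespace BudgetedCosts

variable {n : ℕ} (w : BudgetedCosts n)

/-- The cost data as a program value. -/
def code : Data :=
  Data.list [Data.vec w.cLo, Data.vec w.cHi, Data.vec w.dLo, Data.vec w.dHi, Data.num w.Γ]

/-- The first-stage uncertainty set. -/
def firstSet : Set (Fin n → ℝ) :=
  {c | (∀ i, 0 ≤ c i) ∧ ∃ δ : Fin n → ℝ,
    (∀ i, c i = w.cLo i + ((w.cHi i : ℝ) - w.cLo i) * δ i) ∧
    (∀ i, δ i ∈ Set.Icc (0 : ℝ) 1) ∧ ∑ i, δ i ≤ w.Γ}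

/-- The budget used by the first-stage costs `c`. An item with equal lower and upper cost uses
nothing (its summand is `0 / 0 = 0`). -/
noncomputable def usedBudget (c : Fin n → ℝ) : ℝ :=
  ∑ i, (c i - w.cLo i) / ((w.cHi i : ℝ) - w.cLo i)

/-- The second-stage uncertainty set after the first-stage costs `c`. -/
def secondSet (c : Fin n → ℝ) : Set (Fin n → ℝ) :=
  {d | (∀ i, 0 ≤ d i) ∧ ∃ δ : Fin n → ℝ,
    (∀ i, d i = w.dLo i + ((w.dHi i : ℝ) - w.dLo i) * δ i) ∧
    (∀ i, δ i ∈ Set.Icc (0 : ℝ) 1) ∧ ∑ i, δ i ≤ w.Γ - w.usedBudget c}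

end BudgetedCosts

/-- The value of the adversarial problem for the first-stage solution `x`; it is `⊤` if `x` has
no feasible completion. -/
noncomputable def adversarialValue (N : NominalInstance) (w : BudgetedCosts N.n)
    (x : BinVec N.n) : EReal :=
  ⨆ c ∈ w.firstSet, ⨅ y ∈ N.secondStage x, ⨆ d ∈ w.secondSet c,
    ((c ⬝ᵥ x.toReal + d ⬝ᵥ y.toReal : ℝ) : EReal)

/-- The robust problem: choose `x ∈ {0,1}ⁿ` with the least adversarial value. -/
noncomputable def CombinatorialProblem.robustProblem (P : CombinatorialProblem) : MinProblem where
  Inst := Σ I : P.Inst, BudgetedCosts (P.nominal I).n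
  code := fun J => Data.pair (P.code J.1) J.2.code
  Sol := fun J => BinVec (P.nominal J.1).n
  solCode := fun _ x => x.code
  value := fun J x => adversarialValue (P.nominal J.1) J.2 x

end TwoStage

/-! Fix `x`. If the adversary reserves `t` of the budget for the first stage, each stage is a
fractional knapsack with unit weights, and LP duality replaces its maximum by a minimum over one
price: `min_σ f(σ) + σ t` for the first stage, `min_π g(π, y) + π (Γ - t)` for a completion `y`,
where `f` and `g` are the `reducedCost` of `x` and `y`. The prices may be restricted to `0` and the
cost ranges of the items. So the adversary maximizes over `t ∈ [0, Γ]` the minimum of finitely many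
affine functions of slope `σ - π`.

At an optimal interior `t` some active function has slope `≤ 0` and some has slope `≥ 0`
(`exists_isMax_min_affine`). Mixing active functions so that the slope vanishes leaves at most two
completions `y`, `z` with prices `p`, `q`, weights `l`, `1 - l` and first-stage price `l p + (1 - l)
q`; this is `dualBound`. It bounds the adversarial value from above for all prices `p, q ≥ 0` and `l
∈ [0, 1]` (`adversarialValue_le_dualBound`), and the bound is tight for suitable candidates `s, p,
q` that determine `l` by `s = l p + (1 - l) q` when `p ≠ q`
(`exists_dualBound_le_adversarialValue`).

For fixed prices `dualBound` is linear in `x, y, z` with nonnegative rational coefficients, hence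
the objective of a two-completion instance. Running the given algorithm on all `(2n + 1)³` candidate
triples and keeping the `x` of the least objective loses only the factor `α`.

The other half shows that this search is a polynomial time program. `PolyTime` is closed under
composition, pairing, branching and loops over lists; loops need an encoding length that arithmetic
increases additively, which is `Data.weight`. -/

namespace TwoStage

/-! ## Frame rule and subroutine calls -/

/-- All variables of the expression are less than `e.bound`. -/
def Term.bound : Term → ℕ
  | var v => v + 1
  | const _ => 0
  | pair e f => max e.bound f.bound
  | fst e => e.bound
  | snd e => e.bound
  | isPair e => e.bound
  | add e f => max e.bound f.bound
  | sub e f => max e.bound f.bound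
  | mul e f => max e.bound f.bound
  | div e f => max e.bound f.bound
  | le e f => max e.bound f.bound

/-- All variables of the program are less than `c.bound`. -/
def Program.bound : Program → ℕ
  | assign v e => max (v + 1) e.bound
  | seq c₁ c₂ => max c₁.bound c₂.bound
  | ite e c₁ c₂ => max e.bound (max c₁.bound c₂.bound)
  | loop e c => max e.bound c.bound

theorem Term.eval_congr {s r : Store} (e : Term) {M : ℕ} (hM : e.bound ≤ M)
    (h : ∀ v < M, r v = s v) : e.eval r = e.eval s := by
  induction e with
  | var v => exact h v (by simp only [Term.bound] at hM; omega)
  | const q => rfl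
  | fst e ih => simp only [Term.eval, ih hM]
  | snd e ih => simp only [Term.eval, ih hM]
  | isPair e ih => simp only [Term.eval, ih hM]
  | _ e f ihe ihf =>
    simp only [Term.bound, max_le_iff] at hM
    simp only [Term.eval, ihe hM.1, ihf hM.2]

theorem Term.cost_congr {s r : Store} (e : Term) {M : ℕ} (hM : e.bound ≤ M)
    (h : ∀ v < M, r v = s v) : e.cost r = e.cost s := by
  induction e with
  | var v => exact congrArg Data.size (h v (by simp only [Term.bound] at hM; omega))
  | const q => rfl
  | fst e ih => simp only [Term.cost, Term.eval, ih hM, e.eval_congr hM h]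
  | snd e ih => simp only [Term.cost, Term.eval, ih hM, e.eval_congr hM h]
  | isPair e ih => simp only [Term.cost, Term.eval, ih hM, e.eval_congr hM h]
  | _ e f ihe ihf =>
    simp only [Term.bound, max_le_iff] at hM
    simp only [Term.cost, Term.eval, ihe hM.1, ihf hM.2, e.eval_congr hM.1 h,
      f.eval_congr hM.2 h]

/-- A run depends only on, and changes only, the variables below a bound of the program. -/
theorem Program.Runs.frame {c : Program} {s s' : Store} {t : ℕ} (h : c.Runs s t s') {M : ℕ}
    (hM : c.bound ≤ M) {r : Store} (hr : ∀ v < M, r v = s v) :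
    ∃ r', c.Runs r t r' ∧ (∀ v < M, r' v = s' v) ∧ ∀ v, M ≤ v → r' v = r v := by
  induction h generalizing r with
  | assign v e s =>
    simp only [Program.bound, max_le_iff] at hM
    refine ⟨_, e.cost_congr hM.2 hr ▸ Runs.assign v e r, fun u hu => ?_, fun u hu => ?_⟩
    · rw [e.eval_congr hM.2 hr]
      by_cases huv : u = v
      · simp [huv]
      · simp [Function.update_of_ne huv, hr u hu]
    · exact Function.update_of_ne (by omega) _ _
  | seq _ _ ih₁ ih₂ =>
    simp only [Program.bound, max_le_iff] at hM
    obtain ⟨r₁, h₁, ha₁, hb₁⟩ := ih₁ hM.1 hr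
    obtain ⟨r₂, h₂, ha₂, hb₂⟩ := ih₂ hM.2 ha₁
    exact ⟨r₂, .seq h₁ h₂, ha₂, fun v hv => (hb₂ v hv).trans (hb₁ v hv)⟩
  | @ite_true e _ _ _ _ _ he _ ih =>
    simp only [Program.bound, max_le_iff] at hM
    obtain ⟨r₁, h₁, ha₁, hb₁⟩ := ih hM.2.1 hr
    exact ⟨r₁, e.cost_congr hM.1 hr ▸ .ite_true (by rwa [e.eval_congr hM.1 hr]) h₁, ha₁, hb₁⟩
  | @ite_false e _ _ _ _ _ he _ ih =>
    simp only [Program.bound, max_le_iff] at hM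
    obtain ⟨r₁, h₁, ha₁, hb₁⟩ := ih hM.2.2 hr
    exact ⟨r₁, e.cost_congr hM.1 hr ▸ .ite_false (by rwa [e.eval_congr hM.1 hr]) h₁, ha₁, hb₁⟩
  | @loop_true e _ _ _ _ _ _ he _ _ ih₁ ih₂ =>
    have hM' := hM
    simp only [Program.bound, max_le_iff] at hM
    obtain ⟨r₁, h₁, ha₁, hb₁⟩ := ih₁ hM.2 hr
    obtain ⟨r₂, h₂, ha₂, hb₂⟩ := ih₂ hM' ha₁
    exact ⟨r₂, e.cost_congr hM.1 hr ▸ .loop_true (by rwa [e.eval_congr hM.1 hr]) h₁ h₂, ha₂,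
      fun v hv => (hb₂ v hv).trans (hb₁ v hv)⟩
  | @loop_false e _ _ he =>
    simp only [Program.bound, max_le_iff] at hM
    exact ⟨r, e.cost_congr hM.1 hr ▸ .loop_false (by rwa [e.eval_congr hM.1 hr]), hr,
      fun _ _ => rfl⟩

/-- Set the variables `0, …, k` to `0`. -/
def Program.clear : ℕ → Program
  | 0 => .assign 0 (.const 0)
  | k + 1 => .seq (clear k) (.assign (k + 1) (.const 0))

/-- Run `c`, a program for the variables `0, …, k`, on the value of the variable `v`. -/
def Program.call (c : Program) (k v : ℕ) : Program :=
  .seq (.clear k) (.seq (.assign 0 (.var v)) c)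

theorem Data.size_num_zero : (Data.num 0).size = 2 := by
  simp [Data.size]

theorem Program.runs_clear (k : ℕ) (r : Store) :
    (Program.clear k).Runs r (3 * (k + 1)) (fun v => if v ≤ k then .num 0 else r v) := by
  induction k with
  | zero =>
    convert Runs.assign 0 (.const 0) r using 1
    · rfl
    · simp [Term.cost, Data.size]
    · funext v; simp [Function.update_apply, Term.eval]
  | succ k ih =>
    convert Runs.seq ih (Runs.assign (k + 1) (.const 0) _) using 1
    · rfl
    · simp [Term.cost, Data.size]; ring
    · funext v
      by_cases h : v = k + 1
      · simp [h, Term.eval]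
      · have : v ≤ k + 1 ↔ v ≤ k := by omega
        simp [Function.update_of_ne h, this]

/-- After clearing and copying, the store agrees with `initStore d` on all variables that `c`
mentions, so the frame rule transfers the run. The variables above `k` survive and serve as the
memory of the caller. -/
theorem Program.runs_call {c : Program} {k v : ℕ} (hk : c.bound ≤ k + 1) (hv : k < v) {d : Data}
    {t : ℕ} {s : Store} (h : c.Runs (initStore d) t s) {r : Store} (hr : r v = d) :
    ∃ r', (c.call k v).Runs r (3 * (k + 1) + (d.size + 1 + t)) r' ∧ r' 0 = s 0 ∧
      ∀ u, k < u → r' u = r u := by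
  set r₁ : Store := fun u => if u ≤ k then .num 0 else r u
  have hr₁ : r₁ v = d := by simp [r₁, hv, hr]
  have hr₂ : ∀ u < k + 1, Function.update r₁ 0 (r₁ v) u = initStore d u := by
    intro u hu
    by_cases h0 : u = 0
    · simp [h0, initStore, hr₁]
    · simp [initStore, r₁, h0, Nat.le_of_lt_succ hu]
  obtain ⟨r', h₁, h₂, h₃⟩ := h.frame hk hr₂
  refine ⟨r', ?_, h₂ 0 (by omega), fun u hu => ?_⟩
  · have := Runs.seq (runs_clear k r) (Runs.seq (Runs.assign 0 (.var v) r₁) h₁)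
    simpa only [Program.call, Term.cost, hr₁] using this
  · rw [h₃ u hu, Function.update_of_ne (by omega)]
    simp [r₁, hu]

/-! ### Running time bounds the size of the data -/

theorem Data.two_le_size (d : Data) : 2 ≤ d.size := by
  induction d with
  | num q =>
    have : 0 < Nat.size q.den := Nat.size_pos.2 q.den_pos
    simp only [Data.size]; omega
  | pair a b iha ihb => simp only [Data.size]; omega

theorem Term.size_eval_le_cost (e : Term) (s : Store) : (e.eval s).size ≤ e.cost s := by
  cases e <;> simp only [Term.cost, Term.eval] <;> omega

/-- An assignment pays at least the size of the value that it stores, so a polynomial running time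
forces polynomially large outputs. -/
theorem Program.Runs.size_le {c : Program} {s s' : Store} {t : ℕ} (h : c.Runs s t s') {B : ℕ}
    (hB : ∀ v, (s v).size ≤ B) (v : ℕ) : (s' v).size ≤ B + t := by
  induction h generalizing B v with
  | assign u e s =>
    by_cases huv : v = u
    · have := e.size_eval_le_cost s
      simp only [huv, Function.update_self]; omega
    · have := hB v
      simp only [Function.update_of_ne huv]; omega
  | seq _ _ ih₁ ih₂ =>
    have := ih₂ (fun u => ih₁ hB u) v
    omega
  | ite_true _ _ ih => have := ih hB v; omega
  | ite_false _ _ ih => have := ih hB v; omega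
  | loop_true _ _ _ ih₁ ih₂ => have := ih₂ (fun u => ih₁ hB u) v; omega
  | loop_false _ => have := hB v; omega

/-! ## Polynomial time computable families -/

theorem eval_mono (p : Polynomial ℕ) {a b : ℕ} (h : a ≤ b) : p.eval a ≤ p.eval b := by
  simp only [Polynomial.eval_eq_sum, Polynomial.sum]
  gcongr

/-- Some program computes `f i` from `e i`, in time polynomial in the size of `e i`. -/
def PolyTime {ι : Type*} (e f : ι → Data) : Prop :=
  ∃ (c : Program) (p : Polynomial ℕ), ∀ i, ∃ (t : ℕ) (s : Store),
    c.Runs (initStore (e i)) t s ∧ t ≤ p.eval (e i).size ∧ s 0 = f i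

theorem size_initStore_le (d : Data) (v : ℕ) : (initStore d v).size ≤ d.size := by
  unfold initStore
  split_ifs
  · exact le_rfl
  · exact Data.size_num_zero.trans_le d.two_le_size

namespace PolyTime

variable {ι : Type*} {e f g : ι → Data}

theorem size_le (h : PolyTime e f) :
    ∃ q : Polynomial ℕ, ∀ i, (f i).size ≤ q.eval (e i).size := by
  obtain ⟨c, p, h⟩ := h
  refine ⟨.X + p, fun i => ?_⟩
  obtain ⟨t, s, hr, ht, h0⟩ := h i
  have := hr.size_le (size_initStore_le (e i)) 0
  rw [h0] at this
  simp only [Polynomial.eval_add, Polynomial.eval_X]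
  omega

theorem reindex {κ : Type*} (h : PolyTime e f) (σ : κ → ι) :
    PolyTime (fun k => e (σ k)) (fun k => f (σ k)) := by
  obtain ⟨c, p, h⟩ := h
  exact ⟨c, p, fun k => h (σ k)⟩

theorem comp (hf : PolyTime e f) (hg : PolyTime f g) : PolyTime e g := by
  obtain ⟨q, hq⟩ := hf.size_le
  obtain ⟨c, p, hf⟩ := hf
  obtain ⟨c', p', hg⟩ := hg
  set k := c'.bound
  -- The intermediate result is parked in variable `k + 1`, out of reach of `c'`. Its size is at
  -- most `q`, hence the time `p'.comp q` for the second program.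
  refine ⟨.seq c (.seq (.assign (k + 1) (.var 0)) (c'.call k (k + 1))),
    p + (q + 1 + (3 * (Polynomial.C k + 1) + (q + 1 + p'.comp q))), fun i => ?_⟩
  obtain ⟨t, s, hr, ht, h0⟩ := hf i
  obtain ⟨t', s', hr', ht', h0'⟩ := hg i
  obtain ⟨r, h₁, h₂, -⟩ := Program.runs_call (r := Function.update s (k + 1) (s 0))
    (Nat.le_succ _) (Nat.lt_succ_self k) hr' (by simp [h0])
  refine ⟨_, r, .seq hr (.seq (.assign (k + 1) (.var 0) s) h₁), ?_, h₂.trans h0'⟩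
  have h3 := hq i
  have h4 := eval_mono p' h3
  simp only [Term.cost, h0, Polynomial.eval_add, Polynomial.eval_mul, Polynomial.eval_comp,
    Polynomial.eval_C, Polynomial.eval_one, Polynomial.eval_ofNat]
  omega

theorem pair (hf : PolyTime e f) (hg : PolyTime e g) :
    PolyTime e (fun i => .pair (f i) (g i)) := by
  obtain ⟨q, hq⟩ := hf.size_le
  obtain ⟨q', hq'⟩ := hg.size_le
  obtain ⟨c, p, hf⟩ := hf
  obtain ⟨c', p', hg⟩ := hg
  set k := max c.bound c'.bound
  have hk : c.bound ≤ k + 1 := (le_max_left _ _).trans (Nat.le_succ _)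
  have hk' : c'.bound ≤ k + 1 := (le_max_right _ _).trans (Nat.le_succ _)
  -- Variable `k + 1` keeps the input and `k + 2` the first result; both calls leave them alone.
  refine ⟨.seq (.assign (k + 1) (.var 0)) (.seq (c.call k (k + 1)) (.seq
    (.assign (k + 2) (.var 0)) (.seq (c'.call k (k + 1))
    (.assign 0 (.pair (.var (k + 2)) (.var 0)))))),
    .X + 1 + (3 * (Polynomial.C k + 1) + (.X + 1 + p) + (q + 1 +
      (3 * (Polynomial.C k + 1) + (.X + 1 + p') + (q + q' + (1 + q + q') + 1)))), fun i => ?_⟩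
  obtain ⟨t, s, hr, ht, h0⟩ := hf i
  obtain ⟨t', s', hr', ht', h0'⟩ := hg i
  set r₀ := Function.update (initStore (e i)) (k + 1) (e i)
  obtain ⟨r₁, h₁, ha₁, hb₁⟩ := Program.runs_call (r := r₀) hk (Nat.lt_succ_self k) hr
    (by simp [r₀])
  set r₂ := Function.update r₁ (k + 2) (f i)
  obtain ⟨r₃, h₃, ha₃, hb₃⟩ := Program.runs_call (r := r₂) hk' (Nat.lt_succ_self k) hr'
    (by simp [r₂, r₀, hb₁ (k + 1) (Nat.lt_succ_self k)])
  have e₀ : initStore (e i) 0 = e i := by simp [initStore]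
  have e₁ : r₁ 0 = f i := by rw [ha₁, h0]
  have e₃ : r₃ 0 = g i := by rw [ha₃, h0']
  have e₄ : r₃ (k + 2) = f i := by rw [hb₃ _ (by omega)]; simp [r₂]
  have A₁ := Program.Runs.assign (k + 1) (.var 0) (initStore (e i))
  have A₂ := Program.Runs.assign (k + 2) (.var 0) r₁
  have A₃ := Program.Runs.assign 0 (.pair (.var (k + 2)) (.var 0)) r₃
  simp only [Term.eval, Term.cost, e₀, e₁, e₃, e₄, Data.size] at A₁ A₂ A₃
  refine ⟨_, _, .seq A₁ (.seq h₁ (.seq A₂ (.seq h₃ A₃))), ?_, by simp⟩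
  have := hq i
  have := hq' i
  simp only [Polynomial.eval_add, Polynomial.eval_mul, Polynomial.eval_X,
    Polynomial.eval_C, Polynomial.eval_one, Polynomial.eval_ofNat]
  omega

end PolyTime

/-! ### Expressions -/

theorem size_mul_le (a b : ℕ) : (a * b).size ≤ a.size + b.size := by
  rw [Nat.size_le, pow_add]
  exact Nat.mul_lt_mul'' (Nat.lt_size_self a) (Nat.lt_size_self b)

theorem size_add_le (a b : ℕ) : (a + b).size ≤ max a.size b.size + 1 := by
  rw [Nat.size_le, pow_succ]
  have h1 := (Nat.lt_size_self a).trans_le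
    (Nat.pow_le_pow_right (n := 2) (by norm_num) (le_max_left a.size b.size))
  have h2 := (Nat.lt_size_self b).trans_le
    (Nat.pow_le_pow_right (n := 2) (by norm_num) (le_max_right a.size b.size))
  omega

/-- The sum of the absolute value of the numerator and the denominator. -/
def height (q : ℚ) : ℕ := q.num.natAbs + q.den

theorem height_divInt_le (a b : ℤ) (hb : b ≠ 0) :
    height (Rat.divInt a b) ≤ a.natAbs + b.natAbs := by
  refine Nat.add_le_add ?_ ?_
  · rcases eq_or_ne a 0 with rfl | ha
    · simp
    · exact Nat.le_of_dvd (Int.natAbs_pos.2 ha) (Int.natAbs_dvd_natAbs.2 (Rat.num_dvd a hb))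
  · exact Nat.le_of_dvd (Int.natAbs_pos.2 hb) (Int.natCast_dvd.1 (Rat.den_dvd a b))

/-- The product of the heights, expanded, contains the numerator and the denominator of the
unreduced product, and reducing only shrinks them. The sum is treated in the same way. -/
theorem height_mul_le (a b : ℚ) : height (a * b) ≤ height a * height b := by
  rw [Rat.mul_eq_mkRat, ← Rat.divInt_ofNat]
  refine (height_divInt_le _ _
    (by exact_mod_cast (Nat.mul_pos a.den_pos b.den_pos).ne')).trans ?_
  simp only [height, Int.natAbs_mul, Int.natAbs_natCast]
  nlinarith [Nat.zero_le (a.num.natAbs * b.den), Nat.zero_le (a.den * b.num.natAbs)]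

theorem height_add_le (a b : ℚ) : height (a + b) ≤ height a * height b := by
  have hab : a + b = Rat.divInt (a.num * b.den + b.num * a.den) (a.den * b.den) := by
    rw [Rat.add_def', ← Rat.divInt_ofNat]; push_cast; rfl
  rw [hab]
  refine (height_divInt_le _ _
    (by exact_mod_cast (Nat.mul_pos a.den_pos b.den_pos).ne')).trans ?_
  have h := Int.natAbs_add_le (a.num * b.den) (b.num * a.den)
  simp only [height, Int.natAbs_mul, Int.natAbs_natCast] at h ⊢
  nlinarith [Nat.zero_le (a.num.natAbs * b.num.natAbs)]

theorem height_neg (a : ℚ) : height (-a) = height a := by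
  simp [height]

theorem height_inv_le (a : ℚ) : height a⁻¹ ≤ height a := by
  rcases eq_or_ne a 0 with rfl | ha
  · simp
  · rw [Rat.inv_def]
    refine (height_divInt_le _ _ (Rat.num_ne_zero.2 ha)).trans_eq ?_
    simp [height, add_comm]

/-- A variant of the encoding length that is subadditive under the arithmetic operations. -/
def Data.weight : Data → ℕ
  | num q => 1 + Nat.size (height q)
  | pair a b => 1 + a.weight + b.weight

namespace Data

theorem weight_le_size (d : Data) : d.weight ≤ d.size := by
  induction d with
  | num q =>
    have h1 : 0 < Nat.size q.den := Nat.size_pos.2 q.den_pos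
    have h2 := size_add_le q.num.natAbs q.den
    simp only [weight, size, height]
    rcases Nat.eq_zero_or_pos q.num.natAbs with h | h
    · simp [h]
    · have := Nat.size_pos.2 h
      omega
  | pair a b iha ihb => simp only [weight, size]; omega

theorem size_le_two_mul_weight (d : Data) : d.size ≤ 2 * d.weight := by
  induction d with
  | num q =>
    have h1 : q.num.natAbs.size ≤ (height q).size := Nat.size_le_size (Nat.le_add_right _ _)
    have h2 : q.den.size ≤ (height q).size := Nat.size_le_size (Nat.le_add_left _ _)
    simp only [weight, size]
    omega
  | pair a b iha ihb => simp only [weight, size]; omega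

theorem weight_num_zero : (num 0).weight = 2 := by
  simp [weight, height]

theorem weight_num_one : (num 1).weight = 3 := by
  simp [weight, height, Nat.size, Nat.binaryRec]

theorem two_le_weight (d : Data) : 2 ≤ d.weight := by
  induction d with
  | num q =>
    have : 0 < (height q).size := Nat.size_pos.2 (Nat.add_pos_right _ q.den_pos)
    simp only [weight]; omega
  | pair a b iha ihb => simp only [weight]; omega

theorem weight_toRat_le (d : Data) : (num d.toRat).weight ≤ d.weight := by
  cases d with
  | num q => exact le_rfl
  | pair a b => exact weight_num_zero.trans_le (two_le_weight _)

/-- The slack `2` is for leaves, where both subtrees are read as the leaf `0`, of weight `2` each.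
The bound shows that a loop that only moves subtrees around does not let them grow. -/
theorem weight_fst_add_snd_le (d : Data) : d.fst.weight + d.snd.weight ≤ d.weight + 2 := by
  cases d with
  | num q =>
    have := two_le_weight (num q)
    simp only [fst, snd, weight_num_zero]; omega
  | pair a b => simp only [fst, snd, weight]; omega

theorem weight_num_mul_le (a b : ℚ) : (num (a * b)).weight ≤ (num a).weight + (num b).weight := by
  have := (Nat.size_le_size (height_mul_le a b)).trans (size_mul_le _ _)
  simp only [weight]; omega

theorem weight_num_add_le (a b : ℚ) : (num (a + b)).weight ≤ (num a).weight + (num b).weight := by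
  have := (Nat.size_le_size (height_add_le a b)).trans (size_mul_le _ _)
  simp only [weight]; omega

theorem weight_num_sub_le (a b : ℚ) : (num (a - b)).weight ≤ (num a).weight + (num b).weight := by
  have := weight_num_add_le a (-b)
  rw [← sub_eq_add_neg] at this
  simpa only [weight, height_neg] using this

theorem weight_num_div_le (a b : ℚ) : (num (a / b)).weight ≤ (num a).weight + (num b).weight := by
  have h := weight_num_mul_le a b⁻¹
  have h' := Nat.size_le_size (height_inv_le b)
  rw [← div_eq_mul_inv] at h
  simp only [weight] at h ⊢
  omega

end Data

namespace Term

theorem weight_eval_pair_le (e f : Term) (s : Store) :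
    ((pair e f).eval s).weight ≤ (e.eval s).weight + (f.eval s).weight + 1 := by
  simp only [eval, Data.weight]; omega

/-- Each operation at most adds the weights of its operands up to a bounded multiple, so the bound
is linear with a constant that depends on the expression only. -/
theorem exists_weight_eval_le (e : Term) :
    ∃ K, ∀ (s : Store) (B : ℕ), (∀ v, (s v).weight ≤ B) → (e.eval s).weight ≤ K * (B + 1) := by
  have aux : ∀ {e f g : Term}, (∀ s, (g.eval s).weight ≤ (e.eval s).weight + (f.eval s).weight + 1) →
      (∃ K, ∀ (s : Store) (B : ℕ), (∀ v, (s v).weight ≤ B) → (e.eval s).weight ≤ K * (B + 1)) →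
      (∃ K, ∀ (s : Store) (B : ℕ), (∀ v, (s v).weight ≤ B) → (f.eval s).weight ≤ K * (B + 1)) →
      ∃ K, ∀ (s : Store) (B : ℕ), (∀ v, (s v).weight ≤ B) → (g.eval s).weight ≤ K * (B + 1) := by
    rintro e f g h ⟨K, hK⟩ ⟨L, hL⟩
    refine ⟨K + L + 1, fun s B hB => (h s).trans ?_⟩
    nlinarith [hK s B hB, hL s B hB]
  have hb : ∀ (b : Prop) [Decidable b], (Data.num (if b then 1 else 0)).weight ≤ 3 := by
    intro b _
    split_ifs
    · exact Data.weight_num_one.le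
    · exact Data.weight_num_zero.le.trans (by norm_num)
  induction e with
  | var v => exact ⟨1, fun s B hB => by have := hB v; simp only [eval]; omega⟩
  | const q => exact ⟨(Data.num q).weight, fun s B hB => by simp only [eval]; nlinarith⟩
  | pair e f ihe ihf => exact aux (fun s => weight_eval_pair_le e f s) ihe ihf
  | fst e ih =>
    refine aux (fun s => ?_) ih ih
    have h1 := (e.eval s).weight_fst_add_snd_le
    have h2 := (e.eval s).snd.two_le_weight
    simp only [eval]; omega
  | snd e ih =>
    refine aux (fun s => ?_) ih ih
    have h1 := (e.eval s).weight_fst_add_snd_le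
    have h2 := (e.eval s).fst.two_le_weight
    simp only [eval]; omega
  | isPair e ih =>
    refine aux (fun s => ?_) ih ih
    have h2 := (e.eval s).two_le_weight
    simp only [eval]
    generalize e.eval s = d at *
    cases d
    · simp only [Data.isPair, Data.weight_num_zero]; omega
    · simp only [Data.isPair, Data.weight_num_one]; omega
  | add e f ihe ihf =>
    refine aux (fun s => ?_) ihe ihf
    have := Data.weight_num_add_le (e.eval s).toRat (f.eval s).toRat
    have := (e.eval s).weight_toRat_le
    have := (f.eval s).weight_toRat_le
    simp only [eval]; omega
  | sub e f ihe ihf =>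
    refine aux (fun s => ?_) ihe ihf
    have := Data.weight_num_sub_le (e.eval s).toRat (f.eval s).toRat
    have := (e.eval s).weight_toRat_le
    have := (f.eval s).weight_toRat_le
    simp only [eval]; omega
  | mul e f ihe ihf =>
    refine aux (fun s => ?_) ihe ihf
    have := Data.weight_num_mul_le (e.eval s).toRat (f.eval s).toRat
    have := (e.eval s).weight_toRat_le
    have := (f.eval s).weight_toRat_le
    simp only [eval]; omega
  | div e f ihe ihf =>
    refine aux (fun s => ?_) ihe ihf
    have := Data.weight_num_div_le (e.eval s).toRat (f.eval s).toRat
    have := (e.eval s).weight_toRat_le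
    have := (f.eval s).weight_toRat_le
    simp only [eval]; omega
  | le e f ihe ihf =>
    refine aux (fun s => ?_) ihe ihf
    have := (e.eval s).two_le_weight
    have := (f.eval s).two_le_weight
    have := hb ((e.eval s).toRat ≤ (f.eval s).toRat)
    simp only [eval]; omega

theorem exists_size_eval_le (e : Term) :
    ∃ K, ∀ (s : Store) (B : ℕ), (∀ v, (s v).size ≤ B) → (e.eval s).size ≤ K * (B + 1) := by
  obtain ⟨K, hK⟩ := e.exists_weight_eval_le
  refine ⟨2 * K, fun s B hB => ?_⟩
  have := hK s B fun v => (s v).weight_le_size.trans (hB v)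
  have := (e.eval s).size_le_two_mul_weight
  nlinarith

theorem exists_cost_le (e : Term) :
    ∃ K, ∀ (s : Store) (B : ℕ), (∀ v, (s v).size ≤ B) → e.cost s ≤ K * (B + 1) := by
  have aux : ∀ {e f g : Term}, (∀ s, g.cost s ≤ e.cost s + f.cost s + (g.eval s).size) →
      (∃ K, ∀ (s : Store) (B : ℕ), (∀ v, (s v).size ≤ B) → e.cost s ≤ K * (B + 1)) →
      (∃ K, ∀ (s : Store) (B : ℕ), (∀ v, (s v).size ≤ B) → f.cost s ≤ K * (B + 1)) →
      ∃ K, ∀ (s : Store) (B : ℕ), (∀ v, (s v).size ≤ B) → g.cost s ≤ K * (B + 1) := by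
    rintro e f g h ⟨K, hK⟩ ⟨L, hL⟩
    obtain ⟨N, hN⟩ := g.exists_size_eval_le
    refine ⟨K + L + N, fun s B hB => (h s).trans ?_⟩
    nlinarith [hK s B hB, hL s B hB, hN s B hB]
  induction e with
  | var v => exact (var v).exists_size_eval_le
  | const q => exact (const q).exists_size_eval_le
  | fst e ih => exact aux (fun s => by simp only [cost]; omega) ih ih
  | snd e ih => exact aux (fun s => by simp only [cost]; omega) ih ih
  | isPair e ih => exact aux (fun s => by simp only [cost]; omega) ih ih
  | _ e f ihe ihf => exact aux (fun s => by simp only [cost]; omega) ihe ihf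

end Term

namespace PolyTime

variable {ι : Type*} {e f g : ι → Data}

theorem term (e : ι → Data) (u : Term) : PolyTime e fun i => u.eval (initStore (e i)) := by
  obtain ⟨K, hK⟩ := u.exists_cost_le
  refine ⟨.assign 0 u, Polynomial.C K * (.X + 1) + 1, fun i => ⟨_, _, .assign 0 u _, ?_, by simp⟩⟩
  have := hK (initStore (e i)) _ (size_initStore_le (e i))
  simp only [Polynomial.eval_add, Polynomial.eval_mul, Polynomial.eval_X, Polynomial.eval_C,
    Polynomial.eval_one]
  omega

/-- Compose with the function of the variable `0` given by an expression. -/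
theorem eval (h : PolyTime e f) (u : Term) (hg : ∀ i, u.eval (initStore (f i)) = g i) :
    PolyTime e g := by
  have := h.comp (term f u)
  simpa only [hg] using this

theorem refl (e : ι → Data) : PolyTime e e :=
  (term e (.var 0)).eval (.var 0) fun _ => rfl

theorem const (e : ι → Data) (q : ℚ) : PolyTime e fun _ => .num q :=
  term e (.const q)

theorem fst (h : PolyTime e f) : PolyTime e fun i => (f i).fst :=
  h.eval (.fst (.var 0)) fun _ => rfl

theorem snd (h : PolyTime e f) : PolyTime e fun i => (f i).snd :=
  h.eval (.snd (.var 0)) fun _ => rfl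

theorem ite {b : ι → Data} (hb : PolyTime e b) (hf : PolyTime e f) (hg : PolyTime e g)
    [∀ i, Decidable (b i = .num 0)] :
    PolyTime e fun i => if b i = .num 0 then g i else f i := by
  refine (hb.pair (hf.pair hg)).comp ⟨.ite (.fst (.var 0)) (.assign 0 (.fst (.snd (.var 0))))
    (.assign 0 (.snd (.snd (.var 0)))), 6 * .X + 6, fun i => ?_⟩
  have h0 : initStore (.pair (b i) (.pair (f i) (g i))) 0 = .pair (b i) (.pair (f i) (g i)) := rfl
  by_cases h : b i = .num 0
  · refine ⟨_, _, .ite_false h (.assign _ _ _), ?_, by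
      exact (Function.update_self _ _ _).trans (if_pos h).symm⟩
    simp only [Term.cost, Term.eval, h0, Data.fst, Data.snd, Data.size, Polynomial.eval_add,
      Polynomial.eval_mul, Polynomial.eval_X, Polynomial.eval_ofNat]
    omega
  · refine ⟨_, _, .ite_true h (.assign _ _ _), ?_, by
      exact (Function.update_self _ _ _).trans (if_neg h).symm⟩
    simp only [Term.cost, Term.eval, h0, Data.fst, Data.snd, Data.size, Polynomial.eval_add,
      Polynomial.eval_mul, Polynomial.eval_X, Polynomial.eval_ofNat]
    omega

end PolyTime

/-! ### Loops over lists -/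

namespace Data

theorem weight_list_cons (d : Data) (l : List Data) :
    (list (d :: l)).weight = 1 + d.weight + (list l).weight := rfl

theorem length_le_weight_list (l : List Data) : l.length ≤ (list l).weight := by
  induction l with
  | nil => exact Nat.zero_le _
  | cons d l ih => rw [weight_list_cons, List.length_cons]; omega

theorem weight_le_weight_list {l : List Data} {d : Data} (h : d ∈ l) :
    d.weight ≤ (list l).weight := by
  induction l with
  | nil => simp at h
  | cons a l ih =>
    rw [weight_list_cons]
    rcases List.mem_cons.1 h with rfl | h
    · omega
    · have := ih h; omega

theorem size_le_size_list {l : List Data} {d : Data} (h : d ∈ l) : d.size ≤ (list l).size := by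
  induction l with
  | nil => simp at h
  | cons a l ih =>
    simp only [list, size]
    rcases List.mem_cons.1 h with rfl | h
    · omega
    · have := ih h; omega

end Data

/-- The running time of a loop over a list, one call of its body for each entry. -/
theorem Program.runs_foldl {α β : Type*} {cβ : β → Data} {cα : α → Data} {step : β → α → α}
    {d : Data} {c : Program} {k : ℕ} (hk : c.bound ≤ k + 1) {T S : ℕ} (l : List β) (a : α)
    (h : ∀ l' b, l' ++ [b] <+: l → ∃ t s,
      c.Runs (initStore (.pair d (.pair (cβ b) (cα (l'.foldl (fun a b => step b a) a))))) t s ∧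
      t ≤ T ∧ s 0 = cα (step b (l'.foldl (fun a b => step b a) a)))
    (hS : ∀ l', l' <+: l → (cα (l'.foldl (fun a b => step b a) a)).size ≤ S)
    (hd : d.size ≤ S) (hl : (Data.list (l.map cβ)).size ≤ S)
    {r : Store} (h1 : r (k + 1) = d) (h2 : r (k + 2) = .list (l.map cβ)) (h3 : r (k + 3) = cα a) :
    ∃ t r', (Program.loop (.isPair (.var (k + 2))) (.seq
        (.assign (k + 4) (.pair (.var (k + 1)) (.pair (.fst (.var (k + 2))) (.var (k + 3)))))
        (.seq (c.call k (k + 4)) (.seq (.assign (k + 3) (.var 0))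
          (.assign (k + 2) (.snd (.var (k + 2)))))))).Runs r t r' ∧
      t ≤ l.length * (T + 3 * (k + 1) + 20 * (S + 1)) + 4 * (S + 1) ∧
      r' (k + 3) = cα (l.foldl (fun a b => step b a) a) := by
  induction l generalizing a r with
  | nil =>
    have h0 : (Term.isPair (.var (k + 2))).eval r = .num 0 := by
      simp only [Term.eval, h2]; rfl
    refine ⟨_, r, .loop_false h0, ?_, h3⟩
    simp only [Term.cost, Term.eval, h2, List.map_nil, Data.list, Data.isPair,
      Data.size_num_zero] at hl ⊢
    omega
  | cons b l ih =>
    obtain ⟨t₁, s₁, hr₁, ht₁, hs₁⟩ := h [] b (by simp)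
    have hS0 := hS [] (List.nil_prefix)
    have hS1 := hS [b] (by simp)
    simp only [List.foldl_nil, List.foldl_cons] at hr₁ hs₁ hS0 hS1
    simp only [List.map_cons, Data.list] at h2 hl
    -- Variables: `k + 1` holds the fixed data, `k + 2` the rest of the list, `k + 3` the
    -- accumulator and `k + 4` the argument of the body.
    have A₁ := Runs.assign (k + 4)
      (.pair (.var (k + 1)) (.pair (.fst (.var (k + 2))) (.var (k + 3)))) r
    simp only [Term.eval, Term.cost, h1, h2, h3, Data.fst, Data.size] at A₁
    set r₁ := Function.update r (k + 4) (.pair d (.pair (cβ b) (cα a)))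
    obtain ⟨r₂, hr₂, ha₂, hb₂⟩ := Program.runs_call (r := r₁) hk (show k < k + 4 by omega) hr₁
      (by simp [r₁])
    rw [hs₁] at ha₂
    have A₂ := Runs.assign (k + 3) (.var 0) r₂
    simp only [Term.eval, Term.cost, ha₂] at A₂
    set r₃ := Function.update r₂ (k + 3) (cα (step b a))
    have e2 : r₃ (k + 2) = .pair (cβ b) (.list (l.map cβ)) := by
      simp [r₃, r₁, hb₂ (k + 2) (by omega), h2]
    have A₃ := Runs.assign (k + 2) (.snd (.var (k + 2))) r₃
    simp only [Term.eval, Term.cost, e2, Data.snd, Data.size] at A₃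
    simp only [Data.size] at hl
    obtain ⟨t, r', hr', ht', he'⟩ := ih (step b a)
      (fun l' b' hb' => by simpa using h (b :: l') b' (by simpa using hb'))
      (fun l' hl' => by simpa using hS (b :: l') (by simpa using hl'))
      (by omega)
      (r := Function.update r₃ (k + 2) (.list (l.map cβ)))
      (by simp [r₃, r₁, hb₂ (k + 1) (by omega), h1]) (by simp) (by simp [r₃])
    have ht : (Term.isPair (.var (k + 2))).eval r ≠ .num 0 := by
      simp [Term.eval, h2, Data.isPair]
    have := Runs.loop_true ht (.seq A₁ (.seq hr₂ (.seq A₂ A₃))) hr'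
    refine ⟨_, r', this, ?_, by simpa using he'⟩
    have h21 : (Data.num 1).size ≤ 3 := by simp [Data.size, Nat.size]
    simp only [Term.cost, Term.eval, h2, Data.isPair, Data.size, List.length_cons] at h21 ⊢
    rw [add_mul]
    omega

namespace PolyTime

variable {ι α β : Type*} {e : ι → Data}

/-- A loop over a list. The accumulated value may grow only by additive amounts. -/
theorem foldl {cβ : β → Data} {cα : α → Data} {step : ι → β → α → α}
    (h : PolyTime (fun x : ι × β × α => .pair (e x.1) (.pair (cβ x.2.1) (cα x.2.2)))
      fun x => cα (step x.1 x.2.1 x.2.2))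
    (q : Polynomial ℕ)
    (hq : ∀ i b a, (cα (step i b a)).weight ≤
      (cα a).weight + q.eval ((e i).weight + (cβ b).weight))
    {L : ι → List β} {a : ι → α} (hL : PolyTime e fun i => .list ((L i).map cβ))
    (ha : PolyTime e fun i => cα (a i)) :
    PolyTime e fun i => cα ((L i).foldl (fun a b => step i b a) (a i)) := by
  have hpair := (refl e).pair (hL.pair ha)
  refine hpair.comp ?_
  obtain ⟨c, p, h⟩ := h
  set k := c.bound
  set Q : Polynomial ℕ := .X + .X * q
  -- At most `N` rounds, each adding weight at most `q(N)` to an initial weight of at most `N`. The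
  -- factor `2` turns weight into size, once and not in every round.
  set S : Polynomial ℕ := 2 * (.X + .X * q)
  refine ⟨.seq (.assign (k + 1) (.fst (.var 0))) (.seq
    (.assign (k + 2) (.fst (.snd (.var 0)))) (.seq (.assign (k + 3) (.snd (.snd (.var 0)))) (.seq
    (.loop (.isPair (.var (k + 2))) (.seq
        (.assign (k + 4) (.pair (.var (k + 1)) (.pair (.fst (.var (k + 2))) (.var (k + 3)))))
        (.seq (c.call k (k + 4)) (.seq (.assign (k + 3) (.var 0))
          (.assign (k + 2) (.snd (.var (k + 2))))))))
      (.assign 0 (.var (k + 3)))))),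
    20 * (.X + 1) + (.X * (p.comp (3 * S + 2) + 3 * (.C k + 1) + 20 * (S + 1)) + 4 * (S + 1))
      + S + 1, fun i => ?_⟩
  set E := e i
  set D := Data.list ((L i).map cβ)
  set A := cα (a i)
  set N := (Data.pair E (.pair D A)).size with hN
  have hN' : N = 1 + E.size + (1 + D.size + A.size) := rfl
  have hw : (Data.pair E (.pair D A)).weight ≤ N := Data.weight_le_size _
  have hw' : (Data.pair E (.pair D A)).weight = 1 + E.weight + (1 + D.weight + A.weight) := rfl
  have hlen : (L i).length ≤ D.weight := by
    have := Data.length_le_weight_list ((L i).map cβ)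
    rwa [List.length_map] at this
  have hfold : ∀ l', l' <+: L i →
      (cα (l'.foldl (fun a b => step i b a) (a i))).weight ≤ A.weight + l'.length * q.eval N := by
    intro l'
    induction l' using List.reverseRecOn with
    | nil => intro; simp [A]
    | append_singleton l' b ih =>
      intro hl'
      have h1 := ih ((List.prefix_append _ _).trans hl')
      have hb : b ∈ L i := hl'.subset (by simp)
      have h2 : _ ≤ D.weight := Data.weight_le_weight_list (List.mem_map_of_mem (f := cβ) hb)
      have h3 : _ ≤ _ + q.eval (E.weight + _) := hq i b (l'.foldl (fun a b => step i b a) (a i))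
      have h4 := eval_mono q (show E.weight + (cβ b).weight ≤ N by omega)
      rw [List.foldl_append, List.length_append, add_mul]
      simp only [List.foldl_cons, List.foldl_nil, List.length_singleton, one_mul]
      omega
  have hSN : S.eval N = 2 * (N + N * q.eval N) := by simp [S]
  have hS : ∀ l', l' <+: L i →
      (cα (l'.foldl (fun a b => step i b a) (a i))).size ≤ S.eval N := by
    intro l' hl'
    have h1 := hfold l' hl'
    have h2 : l'.length * q.eval N ≤ N * q.eval N :=
      Nat.mul_le_mul_right _ (hl'.length_le.trans (by omega))
    have h3 := (cα (l'.foldl (fun a b => step i b a) (a i))).size_le_two_mul_weight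
    omega
  set r := Function.update (Function.update (Function.update (initStore (.pair E (.pair D A)))
    (k + 1) E) (k + 2) D) (k + 3) A
  obtain ⟨t, r', hr, ht, he⟩ := Program.runs_foldl (r := r) (d := E) (step := step i) (cβ := cβ)
    (cα := cα) (k := k) (T := p.eval (3 * S.eval N + 2)) (S := S.eval N) (Nat.le_succ _)
    (L i) (a i) (by
      intro l' b hl'
      obtain ⟨t, s, h1, h2, h3⟩ := h (i, b, l'.foldl (fun a b => step i b a) (a i))
      refine ⟨t, s, h1, h2.trans (eval_mono p ?_), h3⟩
      have hb : b ∈ L i := hl'.subset (by simp)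
      have h4 := hS l' ((List.prefix_append _ _).trans hl')
      have h5 : (cβ b).size ≤ D.size :=
        Data.size_le_size_list (List.mem_map_of_mem (f := cβ) hb)
      -- The argument of the body consists of three parts of size at most `S` and two inner nodes,
      -- hence `3 * S + 2`.
      change 1 + E.size + (1 + (cβ b).size +
        (cα (l'.foldl (fun a b => step i b a) (a i))).size) ≤ _
      omega) hS (by omega) (show D.size ≤ _ by omega)
    (by simp [r]) (by simp [r, D]) (by simp [r, A])
  set s₀ := initStore (.pair E (.pair D A))
  have e₀ : s₀ 0 = .pair E (.pair D A) := rfl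
  have A₁ := Program.Runs.assign (k + 1) (.fst (.var 0)) s₀
  have A₂ := Program.Runs.assign (k + 2) (.fst (.snd (.var 0))) (Function.update s₀ (k + 1) E)
  have A₃ := Program.Runs.assign (k + 3) (.snd (.snd (.var 0)))
    (Function.update (Function.update s₀ (k + 1) E) (k + 2) D)
  have A₄ := Program.Runs.assign 0 (.var (k + 3)) r'
  have n₁ : (0 : ℕ) ≠ k + 1 := by omega
  have n₂ : (0 : ℕ) ≠ k + 2 := by omega
  simp only [Term.eval, Term.cost, Function.update_of_ne n₁, Function.update_of_ne n₂, e₀,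
    Data.fst, Data.snd, he] at A₁ A₂ A₃ A₄
  refine ⟨_, _, .seq A₁ (.seq A₂ (.seq A₃ (.seq hr A₄))), ?_, Function.update_self _ _ _⟩
  have hfin := hS (L i) List.prefix_rfl
  have hmul : (L i).length * (p.eval (3 * S.eval N + 2) + 3 * (k + 1) + 20 * (S.eval N + 1)) ≤
      N * (p.eval (3 * S.eval N + 2) + 3 * (k + 1) + 20 * (S.eval N + 1)) :=
    Nat.mul_le_mul_right _ (by omega)
  have hsz : (Data.pair D A).size = 1 + D.size + A.size := rfl
  simp only [Polynomial.eval_add, Polynomial.eval_mul, Polynomial.eval_X, Polynomial.eval_C,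
    Polynomial.eval_one, Polynomial.eval_ofNat, Polynomial.eval_comp, ← hN, hsz]
  omega


/-- Apply a function to the entries of a list, and reverse the list. -/
theorem reverse_map {cβ : β → Data} {F : ι × β → Data}
    (h : PolyTime (fun x : ι × β => .pair (e x.1) (cβ x.2)) F)
    {L : ι → List β} (hL : PolyTime e fun i => .list ((L i).map cβ)) :
    PolyTime e fun i => .list ((L i).reverse.map fun b => F (i, b)) := by
  obtain ⟨q, hq⟩ := h.size_le
  have hstep : PolyTime (fun x : ι × β × List Data => .pair (e x.1) (.pair (cβ x.2.1)
      (.list x.2.2))) fun x => .list (F (x.1, x.2.1) :: x.2.2) := by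
    set E := fun x : ι × β × List Data => Data.pair (e x.1) (.pair (cβ x.2.1) (.list x.2.2))
    have h1 : PolyTime E fun x => .pair (e x.1) (cβ x.2.1) :=
      (refl E).fst.pair (refl E).snd.fst
    exact (h1.comp (h.reindex fun x : ι × β × List Data => (x.1, x.2.1))).pair (refl E).snd.snd
  have := foldl (step := fun i b l => F (i, b) :: l) (cα := Data.list) (a := fun _ => [])
    hstep (1 + q.comp (2 * (1 + .X))) (fun i b l => by
      have h1 := (hq (i, b)).trans (eval_mono q (Data.size_le_two_mul_weight _))
      have h2 := (F (i, b)).weight_le_size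
      simp only [Data.weight_list_cons, Data.weight, Polynomial.eval_add, Polynomial.eval_mul,
        Polynomial.eval_comp, Polynomial.eval_X, Polynomial.eval_one, Polynomial.eval_ofNat]
        at h1 ⊢
      simp only [add_assoc] at h1 ⊢
      omega) hL (const e 0)
  have hl : ∀ i (l : List β) (l' : List Data), l.foldl (fun a b => F (i, b) :: a) l' =
      (l.reverse.map fun b => F (i, b)) ++ l' := by
    intro i l
    induction l with
    | nil => simp
    | cons b l ih => intro l'; simp [ih]
  simpa only [hl, List.append_nil] using this

/-- Find an entry of least value in a nonempty list. -/
theorem exists_argmin {cβ : β → Data} {val : ι × β → ℚ} {sol : ι × β → Data}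
    (h : PolyTime (fun x : ι × β => .pair (e x.1) (cβ x.2)) fun x => .pair (.num (val x)) (sol x))
    (b₀ : β) (hb₀ : PolyTime e fun _ => cβ b₀)
    {L : ι → List β} (hL : PolyTime e fun i => .list ((L i).map cβ)) :
    ∃ m : ι → β, PolyTime e (fun i => .pair (.num (val (i, m i))) (sol (i, m i))) ∧
      ∀ i, ∀ b ∈ b₀ :: L i, val (i, m i) ≤ val (i, b) := by
  obtain ⟨q, hq⟩ := h.size_le
  set cα : ℚ × Data → Data := fun a => .pair (.num a.1) a.2
  set step : ι → β → ℚ × Data → ℚ × Data := fun i b a =>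
    if val (i, b) ≤ a.1 then (val (i, b), sol (i, b)) else a
  have hstep : PolyTime (fun x : ι × β × (ℚ × Data) => .pair (e x.1) (.pair (cβ x.2.1)
      (cα x.2.2))) fun x => cα (step x.1 x.2.1 x.2.2) := by
    set E := fun x : ι × β × (ℚ × Data) => Data.pair (e x.1) (.pair (cβ x.2.1) (cα x.2.2))
    have h1 : PolyTime E fun x => .pair (e x.1) (cβ x.2.1) :=
      (refl E).fst.pair (refl E).snd.fst
    have h2 := h1.comp (h.reindex fun x : ι × β × (ℚ × Data) => (x.1, x.2.1))
    have h3 : PolyTime E fun x => cα x.2.2 := (refl E).snd.snd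
    have h4 : PolyTime E fun x => .num (if val (x.1, x.2.1) ≤ x.2.2.1 then 1 else 0) :=
      (h2.fst.pair h3.fst).eval (.le (.fst (.var 0)) (.snd (.var 0))) fun _ => rfl
    classical
    have h5 := h4.ite h2 h3
    convert h5 using 2 with x
    by_cases hx : val (x.1, x.2.1) ≤ x.2.2.1 <;> simp [step, hx, cα]
  have h0 : PolyTime e fun i => cα (val (i, b₀), sol (i, b₀)) :=
    ((refl e).pair hb₀).comp (h.reindex fun i => (i, b₀))
  have hfold := foldl hstep (q.comp (2 * (1 + .X))) (fun i b a => by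
      have h1 := (hq (i, b)).trans (eval_mono q (Data.size_le_two_mul_weight _))
      have h2 := (Data.pair (.num (val (i, b))) (sol (i, b))).weight_le_size
      simp only [Data.weight, add_assoc] at h1
      simp only [Polynomial.eval_add, Polynomial.eval_mul, Polynomial.eval_comp,
        Polynomial.eval_X, Polynomial.eval_one, Polynomial.eval_ofNat, step]
      -- The accumulator is either kept or replaced by a fresh value, whose size is bounded
      -- independently of the old one.
      split_ifs
      · change (Data.pair (.num (val (i, b))) (sol (i, b))).weight ≤ _
        omega
      · omega) hL h0
  have hm : ∀ i (l : List β) (b₁ : β), ∃ b, l.foldl (fun a b => step i b a)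
      (val (i, b₁), sol (i, b₁)) = (val (i, b), sol (i, b)) ∧
      ∀ b' ∈ b₁ :: l, val (i, b) ≤ val (i, b') := by
    intro i l
    induction l with
    | nil => exact fun b₁ => ⟨b₁, rfl, by simp⟩
    | cons b l ih =>
      intro b₁
      by_cases hb : val (i, b) ≤ val (i, b₁)
      · obtain ⟨b', h1, h2⟩ := ih b
        refine ⟨b', by simpa [step, hb] using h1, fun c hc => ?_⟩
        rcases List.mem_cons.1 hc with rfl | hc
        · exact (h2 b (by simp)).trans hb
        · exact h2 c hc
      · obtain ⟨b', h1, h2⟩ := ih b₁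
        refine ⟨b', by simpa [step, hb] using h1, fun c hc => ?_⟩
        rcases List.mem_cons.1 hc with rfl | hc
        · exact h2 _ (by simp)
        · rcases List.mem_cons.1 hc with rfl | hc
          · exact (h2 b₁ (by simp)).trans (not_le.1 hb).le
          · exact h2 c (by simp [hc])
  choose m hm₁ hm₂ using fun i => hm i (L i) b₀
  refine ⟨m, ?_, hm₂⟩
  simpa only [hm₁] using hfold

/-- The scalar product of two rational vectors. -/
theorem dotProduct {n : ι → ℕ} {u v : ∀ i, Fin (n i) → ℚ} (hu : PolyTime e fun i => .vec (u i))
    (hv : PolyTime e fun i => .vec (v i)) : PolyTime e fun i => .num (u i ⬝ᵥ v i) := by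
  -- The loop runs over `u`. The accumulator pairs the unread part of `v` with the partial sum, so
  -- the weight of an entry of `v` only moves from the first to the second.
  set step : Data → Data → Data := fun b a =>
    .pair a.fst.snd (.num (a.snd.toRat + b.toRat * a.fst.fst.toRat))
  have hstep : PolyTime (fun x : ι × Data × Data => .pair (e x.1) (.pair (id x.2.1) (id x.2.2)))
      fun x => id (step x.2.1 x.2.2) :=
    (refl _).eval (.pair (.snd (.fst (.snd (.snd (.var 0))))) (.add (.snd (.snd (.snd (.var 0))))
      (.mul (.fst (.snd (.var 0))) (.fst (.fst (.snd (.snd (.var 0)))))))) fun _ => rfl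
  have hfold := foldl (step := fun _ => step) hstep (.X + 10) (fun i b a => by
    have h1 := a.weight_fst_add_snd_le
    have h2 := a.fst.weight_fst_add_snd_le
    have h3 := Data.weight_num_add_le a.snd.toRat (b.toRat * a.fst.fst.toRat)
    have h4 := Data.weight_num_mul_le b.toRat a.fst.fst.toRat
    have h5 := b.weight_toRat_le
    have h6 := a.snd.weight_toRat_le
    have h7 := a.fst.fst.weight_toRat_le
    simp only [Polynomial.eval_add, Polynomial.eval_X, Polynomial.eval_ofNat, id, step,
      Data.weight] at h3 h4 h5 h6 h7 ⊢
    omega) (L := fun i => List.ofFn fun j => .num (u i j))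
    (a := fun i => .pair (.vec (v i)) (.num 0))
    (by simp only [List.map_id]; exact hu) (hv.pair (const e 0))
  have hl : ∀ (n : ℕ) (u v : Fin n → ℚ) (q : ℚ), (List.ofFn fun j => Data.num (u j)).foldl
      (fun a b => step b a) (.pair (.vec v) (.num q)) = .pair (.num 0) (.num (q + u ⬝ᵥ v)) := by
    intro n
    induction n with
    | zero => intro u v q; simp [Data.vec, Data.list]
    | succ n ih =>
      intro u v q
      have := ih (fun j => u j.succ) (fun j => v j.succ) (q + u 0 * v 0)
      simp only [List.ofFn_succ, List.foldl_cons, step, Data.vec, Data.list, Data.fst, Data.snd,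
        Data.toRat] at this ⊢
      rw [this, _root_.dotProduct, _root_.dotProduct, Fin.sum_univ_succ, add_assoc]
  refine hfold.eval (.snd (.var 0)) fun i => ?_
  simp only [id, hl, zero_add]
  rfl

end PolyTime

/-! ## Duality for the adversarial problem -/

/-- Fractional knapsack with unit weights: the greedy solution together with an optimal dual
variable. -/
theorem exists_fractional_knapsack {ι : Type*} [Fintype ι] (w : ι → ℝ) (hw : ∀ i, 0 ≤ w i)
    {β : ℝ} (hβ : 0 ≤ β) :
    ∃ p : ℝ, (p = 0 ∨ ∃ i, p = w i) ∧ ∃ δ : ι → ℝ, (∀ i, δ i ∈ Set.Icc (0 : ℝ) 1) ∧ ∑ i, δ i ≤ β ∧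
      ∑ i, w i * δ i = p * β + ∑ i, max (w i - p) 0 := by
  classical
  set V : Finset ℝ := insert 0 (Finset.univ.image w)
  have hV : ∀ i, w i ∈ V := fun i => by simp [V]
  have hV' : ∀ p ∈ V, p = 0 ∨ ∃ i, p = w i := fun p hp => by
    rcases Finset.mem_insert.1 hp with h | h
    · exact .inl h
    · obtain ⟨i, -, h⟩ := Finset.mem_image.1 h
      exact .inr ⟨i, h.symm⟩
  -- The optimal price is the least breakpoint at which the items of strictly larger value fit into
  -- the budget.
  set S : Finset ℝ := V.filter fun p => ((Finset.univ.filter fun i => p < w i).card : ℝ) ≤ β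
  have hS : S.Nonempty := by
    have hVne : V.Nonempty := ⟨0, by simp [V]⟩
    refine ⟨V.max' hVne, Finset.mem_filter.2 ⟨V.max'_mem _, ?_⟩⟩
    rw [Finset.filter_eq_empty_iff.2 fun i _ => not_lt.2 (V.le_max' _ (hV i))]
    simpa using hβ
  set p := S.min' hS
  obtain ⟨hpV, hpβ⟩ := Finset.mem_filter.1 (S.min'_mem hS)
  have hp0 : 0 ≤ p := by
    rcases hV' p hpV with h | ⟨i, h⟩
    · exact h.ge
    · exact h ▸ hw i
  refine ⟨p, hV' p hpV, ?_⟩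
  rcases hp0.eq_or_lt with h0 | h0
  · refine ⟨fun i => if p < w i then 1 else 0, fun i => by beta_reduce; split_ifs <;> simp,
      by simpa using hpβ, ?_⟩
    rw [← h0, zero_mul, zero_add]
    refine Finset.sum_congr rfl fun i _ => ?_
    beta_reduce
    split_ifs with h
    · rw [mul_one, sub_zero, max_eq_left h.le]
    · rw [mul_zero, sub_zero, max_eq_right (not_lt.1 h)]
  · set k : ℝ := ((Finset.univ.filter fun i => p < w i).card : ℝ) with hk
    set m : ℝ := ((Finset.univ.filter fun i => w i = p).card : ℝ) with hm
    -- The next smaller breakpoint `p'` exists because `0 ∈ V`. It is too cheap by minimality of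
    -- `p`, and the items above it are those of value at least `p`.
    have hkm : β < k + m := by
      have hW : (V.filter (· < p)).Nonempty := ⟨0, Finset.mem_filter.2 ⟨by simp [V], h0⟩⟩
      obtain ⟨hpV', hpp⟩ := Finset.mem_filter.1 (Finset.max'_mem _ hW)
      set p' := (V.filter (· < p)).max' hW
      have hp' : β < ((Finset.univ.filter fun i => p' < w i).card : ℝ) := by
        by_contra h
        exact absurd (S.min'_le p' (Finset.mem_filter.2 ⟨hpV', not_lt.1 h⟩)) (not_le.2 hpp)
      refine hp'.trans_le ?_
      rw [hk, hm, ← Nat.cast_add, Nat.cast_le]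
      refine le_trans (Finset.card_le_card fun i hi => ?_) (Finset.card_union_le _ _)
      have h1 : p ≤ w i := by
        by_contra h
        exact absurd (Finset.le_max' (V.filter (· < p)) (w i)
          (Finset.mem_filter.2 ⟨hV i, not_le.1 h⟩)) (not_le.2 (Finset.mem_filter.1 hi).2)
      rcases h1.eq_or_lt with h | h <;> simp [h]
    have hkβ : k ≤ β := hpβ
    have hm0 : 0 < m := by linarith
    -- The `m` items of value exactly `p` share equally what the `k` better ones leave.
    set r := (β - k) / m
    have hr0 : 0 ≤ r := div_nonneg (by linarith) hm0.le
    have hr1 : r ≤ 1 := (div_le_one hm0).2 (by linarith)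
    have hrm : r * m = β - k := div_mul_cancel₀ _ hm0.ne'
    have hsum : ∀ a b : ℝ, ∑ i, ((if p < w i then a else 0) + if w i = p then b else 0) =
        k * a + m * b := by
      intro a b
      simp [Finset.sum_add_distrib, ← Finset.sum_filter, hk, hm]
    refine ⟨fun i => (if p < w i then 1 else 0) + if w i = p then r else 0, fun i => ?_, ?_, ?_⟩
    · rcases lt_trichotomy p (w i) with h | h | h
      · simp [h, h.ne']
      · simp [← h, hr0, hr1]
      · simp [h.ne, h.not_gt]
    · rw [hsum]; linarith
    · have h1 : ∀ i, w i * ((if p < w i then 1 else 0) + if w i = p then r else 0) =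
          ((if p < w i then p else 0) + if w i = p then p * r else 0) + max (w i - p) 0 := by
        intro i
        rcases lt_trichotomy p (w i) with h | h | h
        · simp [h, h.ne', h.le]
        · simp [← h]
        · simp [h.ne, h.not_gt, h.le]
      simp only [h1]
      rw [Finset.sum_add_distrib, hsum]
      linear_combination p * hrm

/-- The cost of `x` under the costs `lo + (hi - lo - p)⁺`. -/
noncomputable def reducedCost {n : ℕ} (lo hi : Fin n → ℚ) (x : BinVec n) (p : ℝ) : ℝ :=
  ∑ i, ((lo i : ℝ) + max ((hi i : ℝ) - lo i - p) 0) * x.toReal i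

theorem BinVec.toReal_nonneg {n : ℕ} (x : BinVec n) (i : Fin n) : 0 ≤ x.toReal i := by
  unfold toReal; split_ifs <;> norm_num

theorem BinVec.toReal_le_one {n : ℕ} (x : BinVec n) (i : Fin n) : x.toReal i ≤ 1 := by
  unfold toReal; split_ifs <;> norm_num

/-! ### Duality for one stage -/

section reducedCost

variable {n : ℕ} {lo hi : Fin n → ℚ} (x : BinVec n)

theorem reducedCost_antitone : Antitone (reducedCost lo hi x) := fun p q h =>
  Finset.sum_le_sum fun i _ => mul_le_mul_of_nonneg_right
    (add_le_add_right (max_le_max_right _ (by linarith)) _) (x.toReal_nonneg i)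

theorem reducedCost_convex {l p q : ℝ} (h0 : 0 ≤ l) (h1 : l ≤ 1) :
    reducedCost lo hi x (l * p + (1 - l) * q) ≤
      l * reducedCost lo hi x p + (1 - l) * reducedCost lo hi x q := by
  unfold reducedCost
  rw [Finset.mul_sum, Finset.mul_sum, ← Finset.sum_add_distrib]
  refine Finset.sum_le_sum fun i _ => ?_
  have h : max ((hi i : ℝ) - lo i - (l * p + (1 - l) * q)) 0 ≤
      l * max ((hi i : ℝ) - lo i - p) 0 + (1 - l) * max ((hi i : ℝ) - lo i - q) 0 := by
    have h2 : 0 ≤ 1 - l := by linarith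
    refine max_le ?_ (by positivity)
    nlinarith [mul_le_mul_of_nonneg_left (le_max_left ((hi i : ℝ) - lo i - p) 0) h0,
      mul_le_mul_of_nonneg_left (le_max_left ((hi i : ℝ) - lo i - q) 0) h2]
  nlinarith [mul_le_mul_of_nonneg_right h (x.toReal_nonneg i)]

/-- Weak duality for one stage. -/
theorem dotProduct_le_reducedCost (hle : ∀ i, lo i ≤ hi i) {c δ : Fin n → ℝ}
    (hc : ∀ i, c i = lo i + ((hi i : ℝ) - lo i) * δ i) (hδ : ∀ i, δ i ∈ Set.Icc (0 : ℝ) 1)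
    {p : ℝ} (hp : 0 ≤ p) :
    c ⬝ᵥ x.toReal ≤ reducedCost lo hi x p + p * ∑ i, (c i - lo i) / ((hi i : ℝ) - lo i) := by
  unfold reducedCost dotProduct
  rw [Finset.mul_sum, ← Finset.sum_add_distrib]
  refine Finset.sum_le_sum fun i _ => ?_
  have hx := x.toReal_nonneg i
  have hx1 := x.toReal_le_one i
  obtain ⟨h0, h1⟩ := hδ i
  have hC : (0 : ℝ) ≤ (hi i : ℝ) - lo i := sub_nonneg.2 (by exact_mod_cast hle i)
  rw [hc i]
  rcases hC.eq_or_lt with h | h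
  · rw [← h]
    simp only [zero_mul, add_zero, div_zero, mul_zero]
    exact mul_le_mul_of_nonneg_right (le_add_of_nonneg_right (le_max_right _ _)) hx
  · rw [add_sub_cancel_left, mul_div_cancel_left₀ _ h.ne', add_mul, add_mul, add_assoc]
    refine add_le_add_right ?_ _
    have h2 := mul_le_mul_of_nonneg_right (le_max_left ((hi i : ℝ) - lo i - p) 0)
      (mul_nonneg h0 hx)
    have h3 := mul_le_mul_of_nonneg_left (mul_le_mul_of_nonneg_right h1 hx)
      (le_max_right ((hi i : ℝ) - lo i - p) 0)
    have h4 := mul_le_mul_of_nonneg_left hx1 (mul_nonneg hp h0)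
    nlinarith

/-- Equality can fail only at items with equal lower and upper cost, where the quotient is `0 / 0 =
0` although `δ i` may be positive. -/
theorem sum_div_le (hle : ∀ i, lo i ≤ hi i) {c δ : Fin n → ℝ}
    (hc : ∀ i, c i = lo i + ((hi i : ℝ) - lo i) * δ i) (hδ : ∀ i, δ i ∈ Set.Icc (0 : ℝ) 1) :
    ∑ i, (c i - lo i) / ((hi i : ℝ) - lo i) ≤ ∑ i, δ i := by
  refine Finset.sum_le_sum fun i _ => ?_
  have hC : (0 : ℝ) ≤ (hi i : ℝ) - lo i := sub_nonneg.2 (by exact_mod_cast hle i)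
  rw [hc i, add_sub_cancel_left]
  rcases hC.eq_or_lt with h | h
  · rw [← h, div_zero]; exact (hδ i).1
  · rw [mul_div_cancel_left₀ _ h.ne']

/-- The candidates for an optimal dual variable. -/
def dualCandidate (lo hi : Fin n → ℚ) : Option (Fin n) → ℚ
  | none => 0
  | some i => hi i - lo i

/-- Strong duality for one stage. -/
theorem exists_reducedCost_le_dotProduct (hle : ∀ i, lo i ≤ hi i) {β : ℝ} (hβ : 0 ≤ β) :
    ∃ (o : Option (Fin n)) (δ : Fin n → ℝ), (∀ i, δ i ∈ Set.Icc (0 : ℝ) 1) ∧ ∑ i, δ i ≤ β ∧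
      reducedCost lo hi x (dualCandidate lo hi o) + dualCandidate lo hi o * β ≤
        (fun i => (lo i : ℝ) + ((hi i : ℝ) - lo i) * δ i) ⬝ᵥ x.toReal := by
  have hC : ∀ i, (0 : ℝ) ≤ (hi i : ℝ) - lo i := fun i => sub_nonneg.2 (by exact_mod_cast hle i)
  obtain ⟨p, hp, δ, hδ, hs, he⟩ := exists_fractional_knapsack
    (fun i => ((hi i : ℝ) - lo i) * x.toReal i) (fun i => mul_nonneg (hC i) (x.toReal_nonneg i)) hβ
  have hp' : ∃ o, p = dualCandidate lo hi o := by
    rcases hp with rfl | ⟨i, rfl⟩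
    · exact ⟨none, by simp [dualCandidate]⟩
    · by_cases hx : x i
      · exact ⟨some i, by simp [dualCandidate, BinVec.toReal, hx]⟩
      · exact ⟨none, by simp [dualCandidate, BinVec.toReal, hx]⟩
  have hp0 : 0 ≤ p := by
    rcases hp with rfl | ⟨i, rfl⟩
    · exact le_rfl
    · exact mul_nonneg (hC i) (x.toReal_nonneg i)
  obtain ⟨o, rfl⟩ := hp'
  refine ⟨o, δ, hδ, hs, ?_⟩
  have h1 : (fun i => (lo i : ℝ) + ((hi i : ℝ) - lo i) * δ i) ⬝ᵥ x.toReal =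
      ∑ i, (lo i : ℝ) * x.toReal i + ∑ i, ((hi i : ℝ) - lo i) * x.toReal i * δ i := by
    rw [← Finset.sum_add_distrib]
    exact Finset.sum_congr rfl fun i _ => by ring
  rw [h1, he]
  have h2 : reducedCost lo hi x (dualCandidate lo hi o) = ∑ i, (lo i : ℝ) * x.toReal i +
      ∑ i, max (((hi i : ℝ) - lo i) * x.toReal i - dualCandidate lo hi o) 0 := by
    unfold reducedCost
    rw [← Finset.sum_add_distrib]
    refine Finset.sum_congr rfl fun i _ => ?_
    -- For `x i = 0` the maximum on the right vanishes because the price is nonnegative.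
    by_cases hx : x i <;> simp [BinVec.toReal, hx, hp0]
  rw [h2]
  linarith

end reducedCost

/-- The maximizer on `[0, G]` of the minimum of finitely many affine functions. -/
theorem exists_isMax_min_affine {κ : Type*} [Finite κ] [Nonempty κ] (a b : κ → ℝ) {G : ℝ}
    (hG : 0 ≤ G) : ∃ t ∈ Set.Icc 0 G, ∃ M : ℝ, (∀ k, M ≤ a k * t + b k) ∧
      (∃ k, a k * t + b k = M) ∧ (t < G → ∃ k, a k * t + b k = M ∧ a k ≤ 0) ∧
      (0 < t → ∃ k, a k * t + b k = M ∧ 0 ≤ a k) := by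
  cases nonempty_fintype κ
  set φ : ℝ → ℝ := fun t => Finset.univ.inf' Finset.univ_nonempty fun k => a k * t + b k
  have hφ : Continuous φ := Continuous.finset_inf'_apply _ fun k _ => by fun_prop
  have hle : ∀ t k, φ t ≤ a k * t + b k := fun t k => Finset.inf'_le _ (Finset.mem_univ k)
  have hex : ∀ t, ∃ k, a k * t + b k = φ t := fun t => by
    obtain ⟨k, -, hk⟩ := Finset.exists_mem_eq_inf' Finset.univ_nonempty fun k => a k * t + b k
    exact ⟨k, hk.symm⟩
  obtain ⟨t, ht, hmax⟩ := isCompact_Icc.exists_isMaxOn (Set.nonempty_Icc.2 hG) hφ.continuousOn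
  -- If every active function eventually exceeded `φ t` along `l`, then so would `φ`, as the
  -- inactive ones do by continuity. With `l` the right or left neighbourhoods of `t`, this fixes
  -- the sign of a slope.
  have key : ∀ l : Filter ℝ, l.NeBot → l ≤ nhds t → (∀ᶠ u in l, u ∈ Set.Icc 0 G) →
      ∃ k, a k * t + b k = φ t ∧ ∃ᶠ u in l, a k * u + b k ≤ φ t := by
    intro l hl hlt hlG
    by_contra! hcon
    have h1 : ∀ᶠ u in l, ∀ k, φ t < a k * u + b k := by
      refine Filter.eventually_all.2 fun k => ?_
      rcases (hle t k).eq_or_lt with h | h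
      · simpa only [Filter.not_frequently, not_le] using hcon k h.symm
      · have hc : Continuous fun u => a k * u + b k := by fun_prop
        exact hlt ((hc.tendsto t).eventually_const_lt h)
    obtain ⟨u, hu, huG⟩ := (h1.and hlG).exists
    obtain ⟨k, hk⟩ := hex u
    have := hmax huG
    exact absurd (hu k) (not_lt.2 (hk.trans_le this))
  refine ⟨t, ht, φ t, hle t, hex t, fun h => ?_, fun h => ?_⟩
  · obtain ⟨k, hk, hf⟩ := key (nhdsWithin t (Set.Ioi t)) inferInstance nhdsWithin_le_nhds (by
      filter_upwards [Ioo_mem_nhdsGT h] with u hu using ⟨ht.1.trans hu.1.le, hu.2.le⟩)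
    obtain ⟨u, hu, hut⟩ := (hf.and_eventually self_mem_nhdsWithin).exists
    refine ⟨k, hk, ?_⟩
    have : t < u := hut
    by_contra! h'
    nlinarith
  · obtain ⟨k, hk, hf⟩ := key (nhdsWithin t (Set.Iio t)) inferInstance nhdsWithin_le_nhds (by
      filter_upwards [Ioo_mem_nhdsLT h] with u hu using ⟨hu.1.le, hu.2.le.trans ht.2⟩)
    obtain ⟨u, hu, hut⟩ := (hf.and_eventually self_mem_nhdsWithin).exists
    refine ⟨k, hk, ?_⟩
    have : u < t := hut
    by_contra! h'
    nlinarith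

/-- The weight `l ∈ [0, 1]` with `s = l * p + (1 - l) * q`, and `0` if it is not unique or does
not exist. -/
def mixWeight (s p q : ℚ) : ℚ :=
  (s - q) / (p - q) * (if 0 ≤ (s - q) / (p - q) then 1 else 0) *
    (if (s - q) / (p - q) ≤ 1 then 1 else 0)

/-- Valid for all triples, also when `s` is not between `p` and `q`. The search tries all of them,
and each must give nonnegative coefficients and a valid upper bound. -/
theorem mixWeight_mem_Icc (s p q : ℚ) : mixWeight s p q ∈ Set.Icc 0 1 := by
  unfold mixWeight
  split_ifs with h1 h2 h2 <;> simp [h1, h2]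

theorem mixWeight_self (s p : ℚ) : mixWeight s p p = 0 := by
  simp [mixWeight]

theorem mixWeight_spec {s p q : ℚ} (hq : q ≤ s) (hp : s ≤ p) :
    s = mixWeight s p q * p + (1 - mixWeight s p q) * q := by
  rcases (hq.trans hp).eq_or_lt with h | h
  · subst h
    rw [mixWeight_self]
    linarith
  · have h0 : 0 < p - q := sub_pos.2 h
    have h1 : 0 ≤ (s - q) / (p - q) := div_nonneg (sub_nonneg.2 hq) h0.le
    have h2 : (s - q) / (p - q) ≤ 1 := (div_le_one h0).2 (by linarith)
    have h3 : (s - q) / (p - q) * (p - q) = s - q := div_mul_cancel₀ _ h0.ne'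
    rw [mixWeight, if_pos h1, if_pos h2]
    linear_combination -h3

/-! ### Duality for the adversarial problem as a whole -/

namespace BudgetedCosts

variable {n : ℕ} (w : BudgetedCosts n)

/-- The dual objective for the weight `l` of the first completion and the second-stage dual
variables `p` and `q` of the two completions `y` and `z`. -/
noncomputable def dualBound (l p q : ℝ) (x y z : BinVec n) : ℝ :=
  reducedCost w.cLo w.cHi x (l * p + (1 - l) * q) + l * reducedCost w.dLo w.dHi y p +
    (1 - l) * reducedCost w.dLo w.dHi z q + w.Γ * (l * p + (1 - l) * q)

end BudgetedCosts

/-- For given costs `c` the inner minimum is at most the value of `y` and that of `z`, hence at most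
their mixture with weights `l` and `1 - l`. Bounding the stages at the prices `s = l p + (1 - l) q`,
`p` and `q`, the budget used by `c` is charged `s` in the first stage and credited `s` in the
second, and cancels. -/
theorem adversarialValue_le_dualBound {N : NominalInstance} (w : BudgetedCosts N.n)
    {x y z : BinVec N.n} (hy : y ∈ N.secondStage x) (hz : z ∈ N.secondStage x) {l p q : ℝ}
    (hl : l ∈ Set.Icc 0 1) (hp : 0 ≤ p) (hq : 0 ≤ q) :
    adversarialValue N w x ≤ (w.dualBound l p q x y z : EReal) := by
  refine iSup₂_le fun c ⟨_, δ, hc, hδ, _⟩ => ?_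
  have hl' : 0 ≤ 1 - l := sub_nonneg.2 hl.2
  set s := l * p + (1 - l) * q with hs
  have hs0 : 0 ≤ s := add_nonneg (mul_nonneg hl.1 hp) (mul_nonneg hl' hq)
  have hcx := dotProduct_le_reducedCost x w.cLo_le hc hδ hs0
  have key : ∀ (y : BinVec N.n) (p : ℝ), y ∈ N.secondStage x → 0 ≤ p →
      (⨅ y ∈ N.secondStage x, ⨆ d ∈ w.secondSet c, ((c ⬝ᵥ x.toReal + d ⬝ᵥ y.toReal : ℝ) : EReal))
        ≤ ((c ⬝ᵥ x.toReal + (reducedCost w.dLo w.dHi y p + p * (w.Γ - w.usedBudget c)) : ℝ) :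
          EReal) := by
    intro y p hy hp
    refine iInf₂_le_of_le y hy (iSup₂_le fun d ⟨_, ε, hd, hε, hsum⟩ => ?_)
    rw [EReal.coe_le_coe_iff]
    have h1 := dotProduct_le_reducedCost y w.dLo_le hd hε hp
    have h2 := mul_le_mul_of_nonneg_left ((sum_div_le w.dLo_le hd hε).trans hsum) hp
    linarith
  have hy' := key y p hy hp
  have hz' := key z q hz hq
  have hfin : min (c ⬝ᵥ x.toReal + (reducedCost w.dLo w.dHi y p + p * (w.Γ - w.usedBudget c)))
      (c ⬝ᵥ x.toReal + (reducedCost w.dLo w.dHi z q + q * (w.Γ - w.usedBudget c))) ≤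
      w.dualBound l p q x y z := by
    set A := c ⬝ᵥ x.toReal + (reducedCost w.dLo w.dHi y p + p * (w.Γ - w.usedBudget c)) with hA
    set B := c ⬝ᵥ x.toReal + (reducedCost w.dLo w.dHi z q + q * (w.Γ - w.usedBudget c)) with hB
    have h1 := mul_le_mul_of_nonneg_left (min_le_left A B) hl.1
    have h2 := mul_le_mul_of_nonneg_left (min_le_right A B) hl'
    have h3 : l * A + (1 - l) * B = c ⬝ᵥ x.toReal + l * reducedCost w.dLo w.dHi y p +
        (1 - l) * reducedCost w.dLo w.dHi z q + s * (w.Γ - w.usedBudget c) := by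
      rw [hA, hB, hs]; ring
    change _ ≤ reducedCost w.cLo w.cHi x s + _ + _ + w.Γ * s
    change _ ≤ _ + s * w.usedBudget c at hcx
    linarith
  refine le_trans ?_ (EReal.coe_le_coe_iff.2 hfin)
  rcases min_choice (c ⬝ᵥ x.toReal + (reducedCost w.dLo w.dHi y p + p * (w.Γ - w.usedBudget c)))
      (c ⬝ᵥ x.toReal + (reducedCost w.dLo w.dHi z q + q * (w.Γ - w.usedBudget c))) with h | h
  · rwa [h]
  · rwa [h]

/-- The adversary can divide the budget so that every pair of dual variables and every completion
gives at least the value `M`. -/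
theorem le_adversarialValue {N : NominalInstance} (w : BudgetedCosts N.n) {x : BinVec N.n}
    {t M : ℝ} (ht : t ∈ Set.Icc 0 (w.Γ : ℝ))
    (hM : ∀ (o o' : Option (Fin N.n)), ∀ y ∈ N.secondStage x,
      M ≤ reducedCost w.cLo w.cHi x (dualCandidate w.cLo w.cHi o) +
        dualCandidate w.cLo w.cHi o * t + (reducedCost w.dLo w.dHi y (dualCandidate w.dLo w.dHi o')
        + dualCandidate w.dLo w.dHi o' * (w.Γ - t))) :
    (M : EReal) ≤ adversarialValue N w x := by
  -- An optimal attack with budget `t` on the first stage does not depend on `y`, and it leaves at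
  -- least `Γ - t` against whichever completion follows.
  obtain ⟨o, δ, hδ, hsum, ho⟩ := exists_reducedCost_le_dotProduct x w.cLo_le ht.1
  have hc : ∀ i, (0 : ℝ) ≤ (w.cHi i : ℝ) - w.cLo i :=
    fun i => sub_nonneg.2 (by exact_mod_cast w.cLo_le i)
  have hd : ∀ i, (0 : ℝ) ≤ (w.dHi i : ℝ) - w.dLo i :=
    fun i => sub_nonneg.2 (by exact_mod_cast w.dLo_le i)
  set c : Fin N.n → ℝ := fun i => (w.cLo i : ℝ) + ((w.cHi i : ℝ) - w.cLo i) * δ i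
  refine le_iSup₂_of_le c ⟨fun i => add_nonneg (by exact_mod_cast w.cLo_nonneg i)
    (mul_nonneg (hc i) (hδ i).1), δ, fun _ => rfl, hδ, hsum.trans ht.2⟩ (le_iInf₂ fun y hy => ?_)
  have hused : w.usedBudget c ≤ t := (sum_div_le w.cLo_le (fun _ => rfl) hδ).trans hsum
  obtain ⟨o', ε, hε, hsum', ho'⟩ := exists_reducedCost_le_dotProduct y w.dLo_le
    (sub_nonneg.2 ht.2)
  refine le_iSup₂_of_le (fun i => (w.dLo i : ℝ) + ((w.dHi i : ℝ) - w.dLo i) * ε i)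
    ⟨fun i => add_nonneg (by exact_mod_cast w.dLo_nonneg i) (mul_nonneg (hd i) (hε i).1), ε,
      fun _ => rfl, hε, by linarith⟩ ?_
  rw [EReal.coe_le_coe_iff]
  have := hM o o' y hy
  linarith

/-- Strong duality: the adversarial value is attained by the dual objective for candidates. -/
theorem exists_dualBound_le_adversarialValue {N : NominalInstance} (w : BudgetedCosts N.n)
    {x : BinVec N.n} (hx : (N.secondStage x).Nonempty) :
    ∃ s p q : ℚ, (∀ r ∈ [s, p, q], (∃ o, r = dualCandidate w.cLo w.cHi o) ∨
        ∃ o, r = dualCandidate w.dLo w.dHi o) ∧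
      ∃ y ∈ N.secondStage x, ∃ z ∈ N.secondStage x,
        (w.dualBound (mixWeight s p q) p q x y z : EReal) ≤ adversarialValue N w x := by
  have hΓ : (0 : ℝ) ≤ w.Γ := by exact_mod_cast w.Γ_nonneg
  set σ := dualCandidate w.cLo w.cHi
  set π := dualCandidate w.dLo w.dHi
  set f : ℚ → ℝ := fun s => reducedCost w.cLo w.cHi x s with hf
  set g : ℚ → BinVec N.n → ℝ := fun p y => reducedCost w.dLo w.dHi y p with hg
  have hfa : ∀ {p q : ℚ}, p ≤ q → f q ≤ f p := fun h =>
    reducedCost_antitone x (by exact_mod_cast h)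
  have hga : ∀ {p q : ℚ} (y), p ≤ q → g q y ≤ g p y := fun y h =>
    reducedCost_antitone y (by exact_mod_cast h)
  have : Nonempty (N.secondStage x) := hx.to_subtype
  obtain ⟨t, ht, M, hM, hex, hr, hl⟩ := exists_isMax_min_affine
    (κ := Option (Fin N.n) × Option (Fin N.n) × N.secondStage x)
    (fun k => (σ k.1 : ℝ) - π k.2.1)
    (fun k => f (σ k.1) + π k.2.1 * w.Γ + g (π k.2.1) k.2.2) hΓ
  have hAdv : (M : EReal) ≤ adversarialValue N w x := le_adversarialValue w ht fun o o' y hy => by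
    have := hM (o, o', ⟨y, hy⟩)
    simp only [hf, hg] at this
    linarith
  -- Sometimes one completion and one common price suffice: then `s = p = q` and `z = y`.
  have hsingle : ∀ (p : ℚ) (y : N.secondStage x),
      ((∃ o, p = σ o) ∨ ∃ o, p = π o) → f p + g p y + w.Γ * p ≤ M →
      ∃ s p q : ℚ, (∀ r ∈ [s, p, q], (∃ o, r = σ o) ∨ ∃ o, r = π o) ∧
        ∃ y ∈ N.secondStage x, ∃ z ∈ N.secondStage x,
        (w.dualBound (mixWeight s p q) p q x y z : EReal) ≤ adversarialValue N w x := by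
    intro p y hp h
    refine ⟨p, p, p, by simpa using hp, y, y.2, y, y.2,
      le_trans (EReal.coe_le_coe_iff.2 ?_) hAdv⟩
    simpa [mixWeight_self, BudgetedCosts.dualBound] using h
  -- At `t = 0` the price `σ` multiplies no budget, so it can be raised to `π` without increasing
  -- the value. Symmetrically, at `t = Γ` the price `π` can be raised to `σ`.
  have hright : ∀ k : Option (Fin N.n) × Option (Fin N.n) × N.secondStage x,
      (σ k.1 - π k.2.1 : ℝ) * t + (f (σ k.1) + π k.2.1 * w.Γ + g (π k.2.1) k.2.2) = M →
      t = 0 → σ k.1 ≤ π k.2.1 → f (π k.2.1) + g (π k.2.1) k.2.2 + w.Γ * π k.2.1 ≤ M := by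
    intro k hk ht0 hle
    have := hfa hle
    rw [ht0] at hk
    linarith
  have hleft : ∀ k : Option (Fin N.n) × Option (Fin N.n) × N.secondStage x,
      (σ k.1 - π k.2.1 : ℝ) * t + (f (σ k.1) + π k.2.1 * w.Γ + g (π k.2.1) k.2.2) = M →
      t = w.Γ → π k.2.1 ≤ σ k.1 → f (σ k.1) + g (σ k.1) k.2.2 + w.Γ * σ k.1 ≤ M := by
    intro k hk ht0 hle
    have := hga k.2.2 hle
    rw [ht0] at hk
    linarith
  rcases ht.1.eq_or_lt with h0 | h0
  · rcases ht.2.eq_or_lt with h1 | h1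
    · obtain ⟨k, hk⟩ := hex
      rcases le_total (σ k.1) (π k.2.1) with h | h
      · exact hsingle _ k.2.2 (.inr ⟨_, rfl⟩) (hright k hk h0.symm h)
      · exact hsingle _ k.2.2 (.inl ⟨_, rfl⟩) (hleft k hk h1 h)
    · obtain ⟨k, hk, ha⟩ := hr h1
      exact hsingle _ k.2.2 (.inr ⟨_, rfl⟩)
        (hright k hk h0.symm (by exact_mod_cast sub_nonpos.1 ha))
  rcases ht.2.eq_or_lt with h1 | h1
  · obtain ⟨k, hk, ha⟩ := hl h0
    exact hsingle _ k.2.2 (.inl ⟨_, rfl⟩) (hleft k hk h1 (by exact_mod_cast sub_nonneg.1 ha))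
  obtain ⟨⟨o₁, o₂, y⟩, hk, ha⟩ := hr h1
  obtain ⟨⟨o₁', o₂', z⟩, hk', ha'⟩ := hl h0
  -- The value splits into a first-stage and a second-stage part, so exchanging the parts of two
  -- active functions preserves the sum `2 M`. As both exchanged functions are at least `M`, they
  -- are active too.
  have hm := hM (o₁, o₂', z)
  have hm' := hM (o₁', o₂, y)
  simp only at hk ha hk' ha' hm hm'
  have ha : σ o₁ ≤ π o₂ := by exact_mod_cast sub_nonpos.1 ha
  have ha' : π o₂' ≤ σ o₁' := by exact_mod_cast sub_nonneg.1 ha'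
  -- Either `σ o₁` lies between the two second-stage prices, and mixing `y` and `z` cancels the
  -- slope; or `π o₂'` lies between the two first-stage prices, and convexity of `f` lets `z` alone
  -- suffice.
  rcases le_total (π o₂') (σ o₁) with h | h
  · refine ⟨σ o₁, π o₂, π o₂', by simp, y, y.2, z, z.2,
      le_trans (EReal.coe_le_coe_iff.2 ?_) hAdv⟩
    have hs := mixWeight_spec h ha
    set l := mixWeight (σ o₁) (π o₂) (π o₂')
    have hs' : (σ o₁ : ℝ) = l * π o₂ + (1 - l) * π o₂' := by exact_mod_cast hs
    have hk2 : ((σ o₁ : ℝ) - π o₂') * t + (f (σ o₁) + π o₂' * w.Γ + g (π o₂') z) = M := by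
      linarith
    unfold BudgetedCosts.dualBound
    rw [← hs']
    change f (σ o₁) + l * g (π o₂) y + (1 - l) * g (π o₂') z + w.Γ * σ o₁ ≤ M
    apply le_of_eq
    linear_combination (l : ℝ) * hk + (1 - (l : ℝ)) * hk2 + (w.Γ - t) * hs'
  · refine hsingle (π o₂') z (.inr ⟨_, rfl⟩) ?_
    have hs := mixWeight_spec h ha'
    have hl01 := mixWeight_mem_Icc (π o₂') (σ o₁') (σ o₁)
    set l := mixWeight (π o₂') (σ o₁') (σ o₁)
    have hs' : (π o₂' : ℝ) = l * σ o₁' + (1 - l) * σ o₁ := by exact_mod_cast hs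
    have hcv := reducedCost_convex (lo := w.cLo) (hi := w.cHi) x (l := l) (p := σ o₁') (q := σ o₁)
      (by exact_mod_cast hl01.1) (by exact_mod_cast hl01.2)
    rw [← hs'] at hcv
    change f (π o₂') ≤ l * f (σ o₁') + (1 - l) * f (σ o₁) at hcv
    have hk2 : ((σ o₁ : ℝ) - π o₂') * t + (f (σ o₁) + π o₂' * w.Γ + g (π o₂') z) = M := by
      linarith
    have : l * f (σ o₁') + (1 - l) * f (σ o₁) + g (π o₂') z + w.Γ * π o₂' = M := by
      linear_combination (l : ℝ) * hk' + (1 - (l : ℝ)) * hk2 + t * hs'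
    linarith

/-! ## The reduction to the two-completion problem -/

namespace BudgetedCosts

variable {n : ℕ} (w : BudgetedCosts n)

/-- The first-stage dual variable. -/
def mixPoint (s p q : ℚ) : ℚ :=
  mixWeight s p q * p + (1 - mixWeight s p q) * q

/-- The coefficients of the dual objective for fixed dual variables. -/
def pairCosts (s p q : ℚ≥0) : PairCosts n where
  a i := w.cLo i + max (w.cHi i - w.cLo i - mixPoint s p q) 0
  b i := mixWeight s p q * (w.dLo i + max (w.dHi i - w.dLo i - p) 0)
  c i := (1 - mixWeight s p q) * (w.dLo i + max (w.dHi i - w.dLo i - q) 0)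
  v := w.Γ * mixPoint s p q
  a_nonneg i := add_nonneg (w.cLo_nonneg i) (le_max_right _ _)
  b_nonneg i := mul_nonneg (mixWeight_mem_Icc _ _ _).1
    (add_nonneg (w.dLo_nonneg i) (le_max_right _ _))
  c_nonneg i := mul_nonneg (sub_nonneg.2 (mixWeight_mem_Icc _ _ _).2)
    (add_nonneg (w.dLo_nonneg i) (le_max_right _ _))
  v_nonneg := mul_nonneg w.Γ_nonneg (add_nonneg (mul_nonneg (mixWeight_mem_Icc _ _ _).1 p.2)
    (mul_nonneg (sub_nonneg.2 (mixWeight_mem_Icc _ _ _).2) q.2))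

/-- The lower and upper costs of the items, in reverse order. -/
def items : List (ℚ × ℚ × ℚ × ℚ) :=
  (List.ofFn fun i => (w.cLo i, w.cHi i, w.dLo i, w.dHi i)).reverse

/-- The cost ranges of all items in both stages. -/
def ranges : List ℚ :=
  w.items.reverse.flatMap fun t => [t.2.1 - t.1, t.2.2.2 - t.2.2.1]

theorem ranges_nonneg {r : ℚ} (hr : r ∈ w.ranges) : 0 ≤ r := by
  simp only [ranges, items, List.reverse_reverse, List.mem_flatMap, List.mem_ofFn] at hr
  obtain ⟨_, ⟨i, rfl⟩, hr⟩ := hr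
  simp only [List.mem_cons, List.not_mem_nil, or_false] at hr
  rcases hr with rfl | rfl
  · exact sub_nonneg.2 (w.cLo_le i)
  · exact sub_nonneg.2 (w.dLo_le i)

/-- The cost ranges as nonnegative rationals. -/
def nnRanges : List ℚ≥0 := w.ranges.map Rat.toNNRat

theorem map_nnRanges : w.nnRanges.map (fun r : ℚ≥0 => Data.num r) = w.ranges.map .num := by
  rw [nnRanges, List.map_map]
  refine List.map_congr_left fun r hr => ?_
  simp [Rat.coe_toNNRat r (w.ranges_nonneg hr)]

/-- The ranges of both stages are pooled, since each of `s`, `p`, `q` may come from either stage. -/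
theorem exists_mem_nnRanges {r : ℚ}
    (hr : (∃ o, r = dualCandidate w.cLo w.cHi o) ∨ ∃ o, r = dualCandidate w.dLo w.dHi o) :
    ∃ r' ∈ 0 :: w.nnRanges, (r' : ℚ) = r := by
  have key : r = 0 ∨ r ∈ w.ranges := by
    simp only [ranges, items, List.reverse_reverse, List.mem_flatMap, List.mem_ofFn]
    rcases hr with ⟨_ | i, rfl⟩ | ⟨_ | i, rfl⟩
    · exact .inl rfl
    · exact .inr ⟨_, ⟨i, rfl⟩, by simp [dualCandidate]⟩
    · exact .inl rfl
    · exact .inr ⟨_, ⟨i, rfl⟩, by simp [dualCandidate]⟩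
  rcases key with rfl | h
  · exact ⟨0, by simp, rfl⟩
  · exact ⟨r.toNNRat, by simpa [nnRanges] using .inr ⟨r, h, rfl⟩,
      Rat.coe_toNNRat r (w.ranges_nonneg h)⟩

end BudgetedCosts

/-- A 0-1 vector as a rational vector. -/
def BinVec.toRat {n : ℕ} (x : BinVec n) : Fin n → ℚ := fun i => if x i then 1 else 0

theorem BinVec.cast_toRat {n : ℕ} (x : BinVec n) (i : Fin n) : (x.toRat i : ℝ) = x.toReal i := by
  unfold toRat toReal; split_ifs <;> simp

/-- The objective of the two-completion problem. -/
def PairCosts.objective {n : ℕ} (u : PairCosts n) (x : BinVec n × BinVec n × BinVec n) : ℚ :=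
  u.a ⬝ᵥ x.1.toRat + u.b ⬝ᵥ x.2.1.toRat + u.c ⬝ᵥ x.2.2.toRat + u.v

theorem PairCosts.cast_objective {n : ℕ} (u : PairCosts n)
    (x : BinVec n × BinVec n × BinVec n) :
    (u.objective x : ℝ) = (fun i => (u.a i : ℝ)) ⬝ᵥ x.1.toReal + (fun i => (u.b i : ℝ)) ⬝ᵥ x.2.1.toReal
        + (fun i => (u.c i : ℝ)) ⬝ᵥ x.2.2.toReal + (u.v : ℝ) := by
  simp [objective, dotProduct, BinVec.cast_toRat]

theorem BudgetedCosts.objective_pairCosts {n : ℕ} (w : BudgetedCosts n) (s p q : ℚ≥0)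
    (x y z : BinVec n) :
    ((w.pairCosts s p q).objective (x, y, z) : ℝ) = w.dualBound (mixWeight s p q) p q x y z := by
  rw [PairCosts.cast_objective]
  simp [pairCosts, dualBound, mixPoint, reducedCost, dotProduct, Finset.mul_sum, mul_assoc]

/-! ### Computing the two-completion instances -/

namespace PolyTime

variable {ι : Type*} {e : ι → Data} {f g : ι → ℚ}

theorem add (hf : PolyTime e fun i => .num (f i)) (hg : PolyTime e fun i => .num (g i)) :
    PolyTime e fun i => .num (f i + g i) :=
  (hf.pair hg).eval (.add (.fst (.var 0)) (.snd (.var 0))) fun _ => rfl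

theorem sub (hf : PolyTime e fun i => .num (f i)) (hg : PolyTime e fun i => .num (g i)) :
    PolyTime e fun i => .num (f i - g i) :=
  (hf.pair hg).eval (.sub (.fst (.var 0)) (.snd (.var 0))) fun _ => rfl

theorem mul (hf : PolyTime e fun i => .num (f i)) (hg : PolyTime e fun i => .num (g i)) :
    PolyTime e fun i => .num (f i * g i) :=
  (hf.pair hg).eval (.mul (.fst (.var 0)) (.snd (.var 0))) fun _ => rfl

theorem div (hf : PolyTime e fun i => .num (f i)) (hg : PolyTime e fun i => .num (g i)) :
    PolyTime e fun i => .num (f i / g i) :=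
  (hf.pair hg).eval (.div (.fst (.var 0)) (.snd (.var 0))) fun _ => rfl

theorem le (hf : PolyTime e fun i => .num (f i)) (hg : PolyTime e fun i => .num (g i)) :
    PolyTime e fun i => .num (if f i ≤ g i then 1 else 0) :=
  (hf.pair hg).eval (.le (.fst (.var 0)) (.snd (.var 0))) fun _ => rfl

theorem max_zero (hf : PolyTime e fun i => .num (f i)) :
    PolyTime e fun i => .num (max (f i) 0) := by
  have := hf.mul ((const e 0).le hf)
  convert this using 3 with i
  split_ifs with h
  · rw [max_eq_left h, mul_one]
  · rw [max_eq_right (not_le.1 h).le, mul_zero]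

theorem mixWeight {s p q : ι → ℚ} (hs : PolyTime e fun i => .num (s i))
    (hp : PolyTime e fun i => .num (p i)) (hq : PolyTime e fun i => .num (q i)) :
    PolyTime e fun i => .num (mixWeight (s i) (p i) (q i)) :=
  have hr := (hs.sub hq).div (hp.sub hq)
  (hr.mul ((const e 0).le hr)).mul (hr.le (const e 1))

end PolyTime

/-- The costs of an item as a program value. -/
def itemCode (t : ℚ × ℚ × ℚ × ℚ) : Data :=
  .pair (.num t.1) (.pair (.num t.2.1) (.pair (.num t.2.2.1) (.num t.2.2.2)))

namespace BudgetedCosts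

variable {ι : Type*} {n : ι → ℕ} (w : ∀ i, BudgetedCosts (n i))

theorem polyTime_items : PolyTime (fun i => (w i).code)
    fun i => .list ((w i).items.map itemCode) := by
  set e : ι → Data := fun i => (w i).code
  -- The four vectors are zipped: the loop runs over the first, and the accumulator holds the unread
  -- parts of the other three and the output, which comes out reversed.
  set step : Data → Data → Data := fun b a =>
    .pair a.fst.snd (.pair a.snd.fst.snd (.pair a.snd.snd.fst.snd (.pair (.pair b (.pair a.fst.fst
      (.pair a.snd.fst.fst a.snd.snd.fst.fst))) a.snd.snd.snd)))
  have hstep : PolyTime (fun x : ι × Data × Data => .pair (e x.1) (.pair (id x.2.1) (id x.2.2)))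
      fun x => id (step x.2.1 x.2.2) := by
    have ha := (PolyTime.refl fun x : ι × Data × Data =>
      Data.pair (e x.1) (.pair (id x.2.1) (id x.2.2))).snd.snd
    have hb := (PolyTime.refl fun x : ι × Data × Data =>
      Data.pair (e x.1) (.pair (id x.2.1) (id x.2.2))).snd.fst
    exact ha.fst.snd.pair (ha.snd.fst.snd.pair (ha.snd.snd.fst.snd.pair ((hb.pair (ha.fst.fst.pair
      (ha.snd.fst.fst.pair ha.snd.snd.fst.fst))).pair ha.snd.snd.snd)))
  have he := PolyTime.refl e
  have hL : PolyTime e fun i => .list ((List.ofFn fun j => .num ((w i).cLo j)).map id) := by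
    simp only [List.map_id]
    exact he.fst
  have hfold := PolyTime.foldl (step := fun _ => step) hstep (.X + 20) (fun i b a => by
    have h1 := a.weight_fst_add_snd_le
    have h2 := a.snd.weight_fst_add_snd_le
    have h3 := a.snd.snd.weight_fst_add_snd_le
    have h4 := a.fst.weight_fst_add_snd_le
    have h5 := a.snd.fst.weight_fst_add_snd_le
    have h6 := a.snd.snd.fst.weight_fst_add_snd_le
    simp only [Polynomial.eval_add, Polynomial.eval_X, Polynomial.eval_ofNat, id, step,
      Data.weight]
    omega) hL
    (a := fun i => .pair (.vec (w i).cHi) (.pair (.vec (w i).dLo) (.pair (.vec (w i).dHi) (.num 0))))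
    (he.snd.fst.pair (he.snd.snd.fst.pair (he.snd.snd.snd.fst.pair (PolyTime.const e 0))))
  have hl : ∀ (n : ℕ) (u v y z : Fin n → ℚ) (out : List Data),
      (List.ofFn fun j => Data.num (u j)).foldl (fun a b => step b a)
        (.pair (.vec v) (.pair (.vec y) (.pair (.vec z) (.list out)))) =
      .pair (.num 0) (.pair (.num 0) (.pair (.num 0)
        (.list ((List.ofFn fun j => itemCode (u j, v j, y j, z j)).reverse ++ out)))) := by
    intro n
    induction n with
    | zero => intro u v y z out; simp [Data.vec, Data.list]
    | succ n ih =>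
      intro u v y z out
      have := ih (fun j => u j.succ) (fun j => v j.succ) (fun j => y j.succ) (fun j => z j.succ)
        (itemCode (u 0, v 0, y 0, z 0) :: out)
      simp only [List.ofFn_succ, List.foldl_cons, step, Data.vec, Data.list, Data.fst, Data.snd,
        itemCode, List.reverse_cons, List.append_assoc, List.singleton_append] at this ⊢
      rw [this]
  convert hfold.snd.snd.snd using 2 with i
  have := hl _ (w i).cLo (w i).cHi (w i).dLo (w i).dHi []
  simp only [id]
  change _ = (List.foldl _ (Data.pair _ (.pair _ (.pair _ (.list [])))) _).snd.snd.snd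
  rw [this]
  simp [Data.snd, items, List.map_reverse, Function.comp_def]

theorem polyTime_ranges : PolyTime (fun i => .list ((w i).items.map itemCode))
    fun i => .list ((w i).nnRanges.map fun r : ℚ≥0 => .num r) := by
  set e : ι → Data := fun i => .list ((w i).items.map itemCode)
  set step : ℚ × ℚ × ℚ × ℚ → List ℚ → List ℚ := fun t l =>
    (t.2.1 - t.1) :: (t.2.2.2 - t.2.2.1) :: l
  have hstep : PolyTime (fun x : ι × (ℚ × ℚ × ℚ × ℚ) × List ℚ => .pair (e x.1)
      (.pair (itemCode x.2.1) (.list (x.2.2.map .num))))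
      fun x => .list ((step x.2.1 x.2.2).map .num) := by
    have hx := PolyTime.refl (fun x : ι × (ℚ × ℚ × ℚ × ℚ) × List ℚ => Data.pair (e x.1)
      (.pair (itemCode x.2.1) (.list (x.2.2.map .num))))
    have ht := hx.snd.fst
    exact (ht.snd.fst.sub ht.fst).pair ((ht.snd.snd.snd.sub ht.snd.snd.fst).pair hx.snd.snd)
  have hfold := PolyTime.foldl (step := fun _ => step) (cα := fun l => .list (l.map .num)) hstep
    (.X + 2) (fun i t l => by
      have h1 := Data.weight_num_sub_le t.2.1 t.1
      have h2 := Data.weight_num_sub_le t.2.2.2 t.2.2.1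
      simp only [Polynomial.eval_add, Polynomial.eval_X, Polynomial.eval_ofNat, step, itemCode,
        List.map_cons, Data.weight_list_cons] at h1 h2 ⊢
      change _ ≤ _ + (_ + (1 + _ + (1 + _ + (1 + _ + _))) + 2)
      omega) (L := fun i => (w i).items) (a := fun _ => []) (PolyTime.refl e) (PolyTime.const e 0)
  have hl : ∀ (l : List (ℚ × ℚ × ℚ × ℚ)) (l' : List ℚ), l.foldl (fun a b => step b a) l' =
      (l.reverse.flatMap fun t => [t.2.1 - t.1, t.2.2.2 - t.2.2.1]) ++ l' := by
    intro l
    induction l with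
    | nil => simp
    | cons b l ih => intro l'; simp [ih, step]
  simpa only [map_nnRanges, ranges, hl, List.append_nil] using hfold

theorem polyTime_pairCosts {s p q : ι → ℚ≥0} : PolyTime
    (fun i => .pair (.list ((w i).items.map itemCode)) (.pair (.num (w i).Γ)
      (.pair (.num (s i)) (.pair (.num (p i)) (.num (q i))))))
    fun i => ((w i).pairCosts (s i) (p i) (q i)).code := by
  set e : ι → Data := fun i => .pair (.list ((w i).items.map itemCode)) (.pair (.num (w i).Γ)
      (.pair (.num (s i)) (.pair (.num (p i)) (.num (q i)))))
  have he := PolyTime.refl e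
  have hΓ : PolyTime e fun i => .num (w i).Γ := he.snd.fst
  have hs : PolyTime e fun i => .num (s i) := he.snd.snd.fst
  have hp : PolyTime e fun i => .num (p i) := he.snd.snd.snd.fst
  have hq : PolyTime e fun i => .num (q i) := he.snd.snd.snd.snd
  have hl := hs.mixWeight hp hq
  have hl' := (PolyTime.const e 1).sub hl
  have hm : PolyTime e fun i => .num (mixPoint (s i) (p i) (q i)) := (hl.mul hp).add (hl'.mul hq)
  have hL : PolyTime e fun i => .list ((w i).items.map itemCode) := he.fst
  set E : ι × (ℚ × ℚ × ℚ × ℚ) → Data := fun x => .pair (e x.1) (itemCode x.2)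
  have hE := PolyTime.refl E
  have lift : ∀ {f : ι → ℚ}, PolyTime e (fun i => .num (f i)) → PolyTime E fun x => .num (f x.1) :=
    fun h => hE.fst.comp (h.reindex Prod.fst)
  have h1 : PolyTime E fun x => .num x.2.1 := hE.snd.fst
  have h2 : PolyTime E fun x => .num x.2.2.1 := hE.snd.snd.fst
  have h3 : PolyTime E fun x => .num x.2.2.2.1 := hE.snd.snd.snd.fst
  have h4 : PolyTime E fun x => .num x.2.2.2.2 := hE.snd.snd.snd.snd
  have vec : ∀ {F : ι × (ℚ × ℚ × ℚ × ℚ) → ℚ}, PolyTime E (fun x => .num (F x)) →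
      PolyTime e fun i => .vec fun j =>
        F (i, (w i).cLo j, (w i).cHi j, (w i).dLo j, (w i).dHi j) := fun h => by
    have := h.reverse_map hL
    -- `reverse_map` undoes the reversal of `items`.
    simp only [items, List.reverse_reverse, List.map_ofFn] at this
    exact this
  have ha := vec (h1.add ((h2.sub h1).sub (lift hm)).max_zero)
  have hb := vec ((lift hl).mul (h3.add ((h4.sub h3).sub (lift hp)).max_zero))
  have hc := vec ((lift hl').mul (h3.add ((h4.sub h3).sub (lift hq)).max_zero))
  exact ha.pair (hb.pair (hc.pair ((hΓ.mul hm).pair (PolyTime.const e 0))))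

end BudgetedCosts

theorem PairCosts.polyTime_objective {ι : Type*} {e : ι → Data} {n : ι → ℕ}
    {u : ∀ i, PairCosts (n i)} {x : ∀ i, BinVec (n i) × BinVec (n i) × BinVec (n i)}
    (hu : PolyTime e fun i => (u i).code)
    (hx : PolyTime e fun i => .list [(x i).1.code, (x i).2.1.code, (x i).2.2.code]) :
    PolyTime e fun i => .num ((u i).objective (x i)) :=
  have ha : PolyTime e fun i => .vec (u i).a := hu.fst
  have hb : PolyTime e fun i => .vec (u i).b := hu.snd.fst
  have hc : PolyTime e fun i => .vec (u i).c := hu.snd.snd.fst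
  have hv : PolyTime e fun i => .num (u i).v := hu.snd.snd.snd.fst
  have h1 : PolyTime e fun i => .vec (x i).1.toRat := hx.fst
  have h2 : PolyTime e fun i => .vec (x i).2.1.toRat := hx.snd.fst
  have h3 : PolyTime e fun i => .vec (x i).2.2.toRat := hx.snd.snd.fst
  (((ha.dotProduct h1).add (hb.dotProduct h2)).add (hc.dotProduct h3)).add hv

/-! ### The search over all triples of prices -/

namespace CombinatorialProblem

variable (P : CombinatorialProblem)

/-- The two-completion instance for fixed dual variables. -/
def pairInstance (J : P.robustProblem.Inst) (s p q : ℚ≥0) : P.pairProblem.Inst :=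
  ⟨J.1, BudgetedCosts.pairCosts J.2 s p q⟩

/-- Solve the two-completion problem for all candidates for the dual variables, and keep a solution
with the least objective value. -/
theorem exists_polyTime_best
    (sol : ∀ K : P.pairProblem.Inst, P.pairProblem.Sol K)
    (hsol : PolyTime P.pairProblem.code fun K => P.pairProblem.solCode K (sol K)) :
    ∃ s p q : P.robustProblem.Inst → ℚ≥0,
      PolyTime P.robustProblem.code
        (fun J => BinVec.code (sol (P.pairInstance J (s J) (p J) (q J))).1) ∧
      ∀ J : P.robustProblem.Inst, ∀ s' ∈ 0 :: J.2.nnRanges, ∀ p' ∈ 0 :: J.2.nnRanges,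
        ∀ q' ∈ 0 :: J.2.nnRanges,
        PairCosts.objective (P.pairInstance J (s J) (p J) (q J)).2
          (sol (P.pairInstance J (s J) (p J) (q J))) ≤
        PairCosts.objective (P.pairInstance J s' p' q').2 (sol (P.pairInstance J s' p' q')) := by
  set e : P.robustProblem.Inst → Data := fun J => .pair (P.code J.1) (.pair (.num J.2.Γ)
    (.pair (.list (J.2.items.map itemCode)) (.list (J.2.nnRanges.map fun r : ℚ≥0 => .num r))))
  have hcode := PolyTime.refl P.robustProblem.code
  have hcosts : PolyTime P.robustProblem.code fun J => BudgetedCosts.code J.2 := hcode.snd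
  have hitems := hcosts.comp (BudgetedCosts.polyTime_items fun J : P.robustProblem.Inst => J.2)
  have hranges := hitems.comp (BudgetedCosts.polyTime_ranges fun J : P.robustProblem.Inst => J.2)
  have he : PolyTime P.robustProblem.code e :=
    hcode.fst.pair (hcosts.snd.snd.snd.snd.fst.pair (hitems.pair hranges))
  set e₁ : P.robustProblem.Inst × ℚ≥0 → Data := fun x => .pair (e x.1) (.num x.2)
  set e₂ : (P.robustProblem.Inst × ℚ≥0) × ℚ≥0 → Data := fun x => .pair (e₁ x.1) (.num x.2)
  set e₃ : ((P.robustProblem.Inst × ℚ≥0) × ℚ≥0) × ℚ≥0 → Data :=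
    fun x => .pair (e₂ x.1) (.num x.2)
  set K : ((P.robustProblem.Inst × ℚ≥0) × ℚ≥0) × ℚ≥0 → P.pairProblem.Inst :=
    fun x => P.pairInstance x.1.1.1 x.1.1.2 x.1.2 x.2
  have hL : PolyTime e fun J => .list (J.2.nnRanges.map fun r : ℚ≥0 => .num r) :=
    (PolyTime.refl e).snd.snd.snd
  have h₃ := PolyTime.refl e₃
  have hcosts' : PolyTime e₃ fun x => PairCosts.code (K x).2 :=
    (h₃.fst.fst.fst.snd.snd.fst.pair (h₃.fst.fst.fst.snd.fst.pair
      (h₃.fst.fst.snd.pair (h₃.fst.snd.pair h₃.snd)))).comp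
      (BudgetedCosts.polyTime_pairCosts
        fun x : ((P.robustProblem.Inst × ℚ≥0) × ℚ≥0) × ℚ≥0 => x.1.1.1.2)
  have hK : PolyTime e₃ fun x => P.pairProblem.code (K x) := h₃.fst.fst.fst.fst.pair hcosts'
  have hS := hK.comp (hsol.reindex K)
  have hval : PolyTime e₃ fun x => .num (PairCosts.objective (K x).2 (sol (K x))) :=
    PairCosts.polyTime_objective hcosts' hS
  have hbest : PolyTime e₃ fun x => .pair (.num (PairCosts.objective (K x).2 (sol (K x))))
      (BinVec.code (sol (K x)).1) := hval.pair hS.fst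
  -- Three nested searches, the innermost over `q`. Each returns a pair of a value and a solution,
  -- which is the input format of the next.
  obtain ⟨q, hq, hq'⟩ := hbest.exists_argmin (cβ := fun r : ℚ≥0 => .num r)
    (L := fun x => x.1.1.2.nnRanges) 0 (PolyTime.const e₂ 0)
    ((PolyTime.refl e₂).fst.fst.comp (hL.reindex fun x : (P.robustProblem.Inst × ℚ≥0) × ℚ≥0 => x.1.1))
  obtain ⟨p, hp, hp'⟩ := hq.exists_argmin (cβ := fun r : ℚ≥0 => .num r)
    (val := fun x => PairCosts.objective (K (x, q x)).2 (sol (K (x, q x))))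
    (sol := fun x => BinVec.code (sol (K (x, q x))).1)
    (L := fun x => x.1.2.nnRanges) 0 (PolyTime.const e₁ 0)
    ((PolyTime.refl e₁).fst.comp (hL.reindex fun x : P.robustProblem.Inst × ℚ≥0 => x.1))
  obtain ⟨s, hs, hs'⟩ := hp.exists_argmin (cβ := fun r : ℚ≥0 => .num r)
    (val := fun x => PairCosts.objective (K ((x, p x), q (x, p x))).2
      (sol (K ((x, p x), q (x, p x)))))
    (sol := fun x => BinVec.code (sol (K ((x, p x), q (x, p x)))).1)
    (L := fun J => J.2.nnRanges) 0 (PolyTime.const e 0) hL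
  refine ⟨s, fun J => p (J, s J), fun J => q ((J, s J), p (J, s J)), (he.comp hs).snd,
    fun J s₁ hs₁ p₁ hp₁ q₁ hq₁ => ?_⟩
  exact (hs' J s₁ hs₁).trans ((hp' (J, s₁) p₁ hp₁).trans (hq' ((J, s₁), p₁) q₁ hq₁))

variable {P}

theorem adversarialValue_le_objective {J : P.robustProblem.Inst} {s p q : ℚ≥0}
    {x y z : BinVec (P.nominal J.1).n} (hy : y ∈ (P.nominal J.1).secondStage x)
    (hz : z ∈ (P.nominal J.1).secondStage x) :
    adversarialValue (P.nominal J.1) J.2 x ≤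
      (((BudgetedCosts.pairCosts J.2 s p q).objective (x, y, z) : ℝ) : EReal) := by
  rw [BudgetedCosts.objective_pairCosts]
  have h := mixWeight_mem_Icc s p q
  exact adversarialValue_le_dualBound J.2 hy hz
    ⟨by exact_mod_cast h.1, by exact_mod_cast h.2⟩ (by exact_mod_cast p.2) (by exact_mod_cast q.2)

theorem pairProblem_value_of_feasible {K : P.pairProblem.Inst} {S : P.pairProblem.Sol K}
    (hS : S.2.1 ∈ (P.nominal K.1).secondStage S.1 ∧ S.2.2 ∈ (P.nominal K.1).secondStage S.1) :
    P.pairProblem.value K S = ((PairCosts.objective K.2 S : ℝ) : EReal) :=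
  (if_pos hS).trans (congrArg _ (PairCosts.cast_objective K.2 S).symm)

theorem feasible_of_pairProblem_value_ne_top {K : P.pairProblem.Inst} {S : P.pairProblem.Sol K}
    (hS : P.pairProblem.value K S ≠ ⊤) :
    S.2.1 ∈ (P.nominal K.1).secondStage S.1 ∧ S.2.2 ∈ (P.nominal K.1).secondStage S.1 := by
  by_contra h
  exact hS (if_neg h)

end CombinatorialProblem

end TwoStage


open TwoStage in
/-- Approximability carries over from the two-completion problem to the robust problem. Duality only
uses that the set of completions is finite, so the integrality of the relaxation is not needed. -/
theorem mainTheorem11 (P : TwoStage.CombinatorialProblem) (hA : P.HasIntegralRelaxation)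
    (α : P.Inst → ℝ) (hα : ∀ I, 1 ≤ α I)
    (h : P.pairProblem.Approximable fun J => α J.1) :
    P.robustProblem.Approximable fun J => α J.1 := by
  obtain ⟨c, r, h⟩ := h
  choose sol t st hrun ht hst hval using h
  obtain ⟨s, p, q, ⟨c', r', hc'⟩, hbest⟩ :=
    P.exists_polyTime_best sol ⟨c, r, fun K => ⟨t K, st K, hrun K, ht K, hst K⟩⟩
  refine ⟨c', r', fun J => ?_⟩
  obtain ⟨t', st', hrun', ht', hst'⟩ := hc' J
  refine ⟨_, t', st', hrun', ht', hst', ?_⟩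
  set K := P.pairInstance J (s J) (p J) (q J)
  have hα0 : (0 : EReal) ≤ α J.1 := by exact_mod_cast zero_le_one.trans (hα J.1)
  have hNe : Nonempty (P.robustProblem.Sol J) := ⟨fun _ => false⟩
  have hFin : Finite (P.robustProblem.Sol J) :=
    inferInstanceAs (Finite (BinVec (P.nominal J.1).n))
  obtain ⟨x, hx⟩ := exists_eq_ciInf_of_finite (f := P.robustProblem.value J)
  change _ ≤ _ * ⨅ x, P.robustProblem.value J x
  rw [← hx]
  change adversarialValue (P.nominal J.1) J.2 (sol K).1 ≤
    _ * adversarialValue (P.nominal J.1) J.2 x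
  rcases ((P.nominal J.1).secondStage x).eq_empty_or_nonempty with hX | hX
  · have hc : (fun i => (J.2.cLo i : ℝ)) ∈ J.2.firstSet :=
      ⟨fun i => Rat.cast_nonneg.2 (J.2.cLo_nonneg i), 0, by simp, by simp,
        by simpa using J.2.Γ_nonneg⟩
    have : adversarialValue (P.nominal J.1) J.2 x = ⊤ := by
      refine top_le_iff.1 (le_iSup₂_of_le _ hc ?_)
      simp [hX]
    rw [this, EReal.coe_mul_top_of_pos (zero_lt_one.trans_le (hα J.1))]
    exact le_top
  obtain ⟨s₀, p₀, q₀, hr, y, hy, z, hz, hdual⟩ := exists_dualBound_le_adversarialValue J.2 hX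
  obtain ⟨s₁, hs₁, rfl⟩ := J.2.exists_mem_nnRanges (hr s₀ (by simp))
  obtain ⟨p₁, hp₁, rfl⟩ := J.2.exists_mem_nnRanges (hr p₀ (by simp))
  obtain ⟨q₁, hq₁, rfl⟩ := J.2.exists_mem_nnRanges (hr q₀ (by simp))
  have hK : ∀ s p q : ℚ≥0, P.pairProblem.value _ (sol (P.pairInstance J s p q)) ≤
      α J.1 * (BudgetedCosts.dualBound J.2 (mixWeight s p q) p q x y z : EReal) := by
    intro s p q
    refine (hval (P.pairInstance J s p q)).trans (mul_le_mul_of_nonneg_left ?_ hα0)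
    refine (iInf_le _ ((x, y, z) : P.pairProblem.Sol (P.pairInstance J s p q))).trans_eq ?_
    exact (CombinatorialProblem.pairProblem_value_of_feasible ⟨hy, hz⟩).trans
      (congrArg _ (J.2.objective_pairCosts s p q x y z))
  -- Feasibility is needed for every triple: the search compares objectives, and an infeasible
  -- solution could have a small one.
  have hfeas : ∀ s p q : ℚ≥0, _ := fun s p q =>
    CombinatorialProblem.feasible_of_pairProblem_value_ne_top
      (ne_top_of_le_ne_top (by rw [← EReal.coe_mul]; exact EReal.coe_ne_top _) (hK s p q))
  have hf := hfeas (s J) (p J) (q J)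
  have hK₁ := (CombinatorialProblem.pairProblem_value_of_feasible
    (hfeas s₁ p₁ q₁)).symm.trans_le (hK s₁ p₁ q₁)
  -- Weak duality at the triple found, its minimality against the triple that is tight for the
  -- optimal `x`, the guarantee `α` there, and strong duality.
  refine (CombinatorialProblem.adversarialValue_le_objective (J := J) (s := s J)
    (p := p J) (q := q J) hf.1 hf.2).trans (le_trans ?_
    (hK₁.trans (mul_le_mul_of_nonneg_left hdual hα0)))
  exact EReal.coe_le_coe_iff.2 (by exact_mod_cast hbest J s₁ hs₁ p₁ hp₁ q₁ hq₁)
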